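/- All digraphs are finite and oriented (no loops, no parallel or antiparallel edges). For a digraph $G=(V,E)$ let $\overline G$ be its underlying undirected graph, $e(A,B)=|\{(a,b)\in E: a\in A,\ b\in B\}|$ for $A,B\subseteq V$, and - $\tau(G)=\max_{A,B\subseteq V}\,(e(A,B)-e(B,A))$, and $\tau^*(G)$ the same maximum over disjoint $A,B$; - $\pi(G)=\frac{|E|}{2}-\beta(G)$, where $\beta(G)$ is the minimum size of a set of edges whose deletion leaves a digraph without directed cycles; - $N(F,\cdot)$ and $N_L(F,\cdot)$: the number of unlabelled copies (subgraphs isomorphic to $F$), respectively labelled copies (injective edge-preserving maps of the vertices of $F$), of a digraph $F$ in a digraph or of an undirected graph $F$ in an undirected graph; $C_k$ is the $k$-cycle, and $C_4^{\rightarrow}$ is the orientation $0\to1\leftarrow2\to3\leftarrow0$ of $C_4$ (it has a homomorphism to a single oriented edge); - $E_k(G)$: the number of $k$-tuples $(v_1,\dots,v_k)\in V^k$ (repetitions allowed, $v_{k+1}:=v_1$) such that for every $i$ exactly one of $(v_i,v_{i+1})$, $(v_{i+1},v_i)$ is an edge, and $(v_{i+1},v_i)\in E$ for an even number of $i$; -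 $A(G)$: the matrix indexed by $V$ with $A_{uv}=1$ if $(u,v)\in E$, $A_{uv}=-1$ if $(v,u)\in E$, and $A_{uv}=0$ otherwise; $A(\overline G)$: the usual $0$-$1$ adjacency matrix; $|\lambda_1(G)|$, $|\lambda_1(\overline G)|$: the largest absolute value of a (complex) eigenvalue of $A(G)$, respectively of $A(\overline G)$; - $\mathrm{bias}_\delta(G)=\max\{e(A,B): A,B\subseteq V,\ e(B,A)\le\delta\, e(A,B)\}$ for $\delta\in(0,1)$. **Theorem.** Let $(G_i)_{i\in\mathbb N}$ be a sequence of digraphs, $G_i$ with $n_i$ vertices and $m_i$ edges, such that $n_i\to\infty$ and $m_i=\Omega(n_i^2)$, that is, for some $c>0$ we have $m_i\ge c\,n_i^2$ for all large $i$. Write $G=G_i$, $m=m_i$, and let $o(\cdot)$ refer to $i\to\infty$. The following are equivalent. 1. $\tau(G)=o(m)$. 2. $\tau^*(G)=o(m)$. 3. $\pi(G)=o(m)$. 4. $N(C_4^{\rightarrow},G)=\left(\frac18+o(1)\right)N(C_4,\overline G)$. 5. For every fixed digraph $B$ with $\overline B$ bipartite, $N_L(B,G)=\left(2^{-|E(B)|}+o(1)\right)N_L(\overline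 B,\overline G)$. 6. For every fixed even $k\ge4$, $E_k(G)=\left(\frac12+o(1)\right)N_L(C_k,\overline G)$. 7. For every fixed even $k\ge4$, $\mathrm{Tr}(A(G)^k)=o\left(\mathrm{Tr}(A(\overline G)^k)\right)$. 8. $|\lambda_1(G)|=o(|\lambda_1(\overline G)|)$. 9. There are $\delta=\delta_i\in(0,1)$ with $\delta_i=1-o(1)$ and $\mathrm{bias}_{\delta_i}(G_i)=o(m)$. Moreover, for each single even $k\ge4$, the condition in 6 for this $k$ alone, and the condition in 7 for this $k$ alone, are also equivalent to 1. -/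

import Mathlib

open Asymptotics Filter Topology

noncomputable section

namespace Digraph

variable {V W : Type*}

/-- A digraph is oriented: no loops and no antiparallel edges (take `u = v` for loops). -/
def IsOriented (G : Digraph V) : Prop := ∀ u v, G.Adj u v → ¬ G.Adj v u

/-- The underlying undirected graph: `u` and `v` are adjacent iff `u ≠ v` and there is an edge
between them in at least one direction. -/
abbrev underlying (G : Digraph V) : SimpleGraph V := G.toSimpleGraphInclusive

/-- The number of edges of a digraph. -/
def numEdges (G : Digraph V) : ℕ := Nat.card {p : V × V // G.Adj p.1 p.2}

open Classical in
/-- `e(A, B)`: the number of edges `(a, b)` with `a ∈ A` and `b ∈ B`. -/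
def edgesBetween (G : Digraph V) (A B : Finset V) : ℕ :=
  ((A ×ˢ B).filter fun p => G.Adj p.1 p.2).card

/-- The directional discrepancy `τ(G) = max_{A, B ⊆ V} (e(A, B) - e(B, A))`. -/
def tau [Fintype V] (G : Digraph V) : ℝ :=
  ⨆ p : Finset V × Finset V, ((G.edgesBetween p.1 p.2 : ℝ) - G.edgesBetween p.2 p.1)

/-- `τ*(G)`: the maximum of `e(A, B) - e(B, A)` over disjoint `A, B ⊆ V`. -/
def tauStar [Fintype V] (G : Digraph V) : ℝ :=
  ⨆ p : {p : Finset V × Finset V // Disjoint p.1 p.2},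
    ((G.edgesBetween p.1.1 p.1.2 : ℝ) - G.edgesBetween p.1.2 p.1.1)

/-- No directed `r`-cycle `v₁ → v₂ → ⋯ → v_r → v₁` for any `r ≥ 1` (`finRotate r` is the cyclic
successor on `Fin r`). -/
def IsAcyclic (G : Digraph V) : Prop :=
  ∀ r : ℕ, 0 < r → ∀ v : Fin r → V, ¬ ∀ i, G.Adj (v i) (v (finRotate r i))

/-- `S` is a set of edges of `G` whose deletion leaves an acyclic digraph. -/
def IsFeedbackArcSet (G : Digraph V) (S : Finset (V × V)) : Prop :=
  (∀ p ∈ S, G.Adj p.1 p.2) ∧ IsAcyclic (Digraph.mk fun a b => G.Adj a b ∧ (a, b) ∉ S)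

/-- `β(G)`: the size of a minimum feedback arc set. -/
def beta (G : Digraph V) : ℕ := sInf {k | ∃ S, G.IsFeedbackArcSet S ∧ S.card = k}

/-- The directed surplus `π(G) = m / 2 - β(G)`. -/
def surplus (G : Digraph V) : ℝ := (G.numEdges : ℝ) / 2 - G.beta

/-- `N_L(B, G)`: the number of labelled copies of `B` in `G`, that is, of injections
`V(B) → V(G)` that map edges of `B` to edges of `G`. -/
def labelledCount (B : Digraph W) (G : Digraph V) : ℕ :=
  Nat.card {f : W ↪ V // ∀ a b, B.Adj a b → G.Adj (f a) (f b)}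

/-- `N(B, G)`: the number of (unlabelled) copies of `B` in `G`, that is, of subdigraphs of `G`,
given by a vertex set and an edge set, that are isomorphic to `B`. -/
def unlabelledCount (B : Digraph W) (G : Digraph V) : ℕ :=
  Set.ncard {H : Set V × Set (V × V) | ∃ f : W ↪ V, (∀ a b, B.Adj a b → G.Adj (f a) (f b)) ∧
    H.1 = Set.range f ∧ H.2 = {p | ∃ a b, B.Adj a b ∧ p = (f a, f b)}}

/-- The orientation of the 4-cycle `0, 1, 2, 3` in which every edge goes from an even to an odd
vertex: `0 → 1 ← 2 → 3 ← 0`. -/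
def fourCycle : Digraph (Fin 4) where
  Adj a b := Even a.val ∧ Odd b.val

open Classical in
/-- The `k`-tuple `v` is an even-switch `k`-cycle. -/
def IsEvenSwitchCycle (G : Digraph V) {k : ℕ} (v : Fin k → V) : Prop :=
  (∀ i, Xor (G.Adj (v i) (v (finRotate k i))) (G.Adj (v (finRotate k i)) (v i))) ∧
    Even (Finset.univ.filter fun i => G.Adj (v (finRotate k i)) (v i)).card

/-- `E_k(G)`: the number of even-switch `k`-cycles, as labelled `k`-tuples. -/
def evenSwitchCount (G : Digraph V) (k : ℕ) : ℕ :=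
  Nat.card {v : Fin k → V // G.IsEvenSwitchCycle v}

open Classical in
/-- The signed adjacency matrix `A(G)` of an oriented graph. -/
def adjMatrix (G : Digraph V) : Matrix V V ℝ :=
  Matrix.of fun u v => if G.Adj u v then 1 else if G.Adj v u then -1 else 0

open Classical in
/-- The usual 0-1 adjacency matrix `A(Ḡ)` of the underlying undirected graph. -/
def underlyingAdjMatrix (G : Digraph V) : Matrix V V ℝ := G.underlying.adjMatrix ℝ

/-- `bias_δ(G) = max {e(A, B) : e(B, A) ≤ δ e(A, B)}`. -/
def bias [Fintype V] (G : Digraph V) (δ : ℝ) : ℝ :=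
  ⨆ p : {p : Finset V × Finset V //
      (G.edgesBetween p.2 p.1 : ℝ) ≤ δ * G.edgesBetween p.1 p.2},
    (G.edgesBetween p.1.1 p.1.2 : ℝ)

end Digraph

/-- `|λ₁|`: the largest absolute value of a complex eigenvalue of a real square matrix. -/
def absLambdaOne {V : Type*} [Fintype V] [DecidableEq V] (M : Matrix V V ℝ) : ℝ :=
  (spectralRadius ℂ (M.map Complex.ofReal)).toReal

end

/-! Write n for the number of vertices. Density turns every normalisation into a power of n: m has
order n², and a bipartite graph on b vertices has order n^b homomorphisms into the underlying graph
(`card_hom_isTheta`), so passing between all maps and injective maps costs a negligible error.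
Everything then turns on the skew-symmetric matrix A(G), whose cut norm is τ up to a constant
(`abs_sum_mul_sum_mul_le`).

Small τ controls counts: a homomorphism sum containing a factor A(G) is at most 4 τ n^(b-2)
(`sq_card_mul_abs_sum_prod_le`). The edge indicator is half of A(Ḡ) + A(G), so directed edges may be
replaced one at a time by half of the undirected ones. Traces of powers of A(G) are sums of the same
kind, and 2 E_k is the sum of the two traces.

Conversely, a single even trace suffices: |λ₁|^k ≤ |Tr A(G)^k| (`absLambdaOne_pow_le`), and τ ≤ |λ₁|
n because A(G) is normal (`tau_le_absLambdaOne`). For the oriented 4-cycle,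
`Matrix.trace_add_trace_le` bounds Tr A(Ḡ)⁴ + Tr A(G)⁴ by 16 times its homomorphism count, so a
count close to the random value forces Tr A(G)⁴ = o(n⁴).

The surplus is sandwiched: τ* ≤ 2π by averaging two orders, and 2π ≤ (n/s + 1) τ + n s by cutting an
optimal order into intervals of length s. The bias is handled by taking 1 - δ of order √(τ/m),
slightly enlarged to stay positive. -/

namespace Digraph

/-! ### Entries of the signed and unsigned adjacency matrices. -/

section Basic

variable {V : Type*} (G : Digraph V)

open Classical in
/-- The indicator function of the edges of a digraph. -/
noncomputable def out (u v : V) : ℝ := if G.Adj u v then 1 else 0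

/-- The entries of the signed adjacency matrix. -/
noncomputable def sgn (u v : V) : ℝ := G.adjMatrix u v

/-- The entries of the adjacency matrix of the underlying undirected graph. -/
noncomputable def und (u v : V) : ℝ := G.underlyingAdjMatrix u v

open Classical in
theorem out_apply (u v : V) : G.out u v = if G.Adj u v then 1 else 0 := rfl

variable {G}

theorem underlying_adj (hG : G.IsOriented) (u v : V) :
    G.underlying.Adj u v ↔ G.Adj u v ∨ G.Adj v u := by
  rw [underlying, toSimpleGraphInclusive, SimpleGraph.fromRel_adj]
  refine ⟨fun h => h.2, fun h => ⟨?_, h⟩⟩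
  rintro rfl
  rcases h with h | h <;> exact hG _ _ h h

theorem sgn_apply_eq (hG : G.IsOriented) (u v : V) :
    G.sgn u v = G.out u v - G.out v u := by
  classical
  have := hG u v
  simp only [sgn, adjMatrix, out, Matrix.of_apply]
  split_ifs <;> simp_all

theorem und_apply_eq (hG : G.IsOriented) (u v : V) :
    G.und u v = G.out u v + G.out v u := by
  classical
  have := hG u v
  simp only [und, underlyingAdjMatrix, out, SimpleGraph.adjMatrix_apply,
    underlying_adj hG]
  split_ifs <;> simp_all

theorem out_apply_eq (hG : G.IsOriented) (u v : V) :
    G.out u v = (G.und u v + G.sgn u v) / 2 := by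
  rw [und_apply_eq hG, sgn_apply_eq hG]
  ring

theorem sgn_swap (hG : G.IsOriented) (u v : V) :
    G.sgn v u = - G.sgn u v := by
  rw [sgn_apply_eq hG, sgn_apply_eq hG]
  ring

theorem sgn_self (hG : G.IsOriented) (u : V) : G.sgn u u = 0 := by
  rw [sgn_apply_eq hG, sub_self]

theorem und_swap (hG : G.IsOriented) (u v : V) :
    G.und v u = G.und u v := by
  rw [und_apply_eq hG, und_apply_eq hG]
  ring

theorem adjMatrix_transpose (hG : G.IsOriented) :
    G.adjMatrix.transpose = - G.adjMatrix := by
  ext u v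
  exact sgn_swap hG u v

theorem underlyingAdjMatrix_transpose (hG : G.IsOriented) :
    G.underlyingAdjMatrix.transpose = G.underlyingAdjMatrix := by
  ext u v
  exact und_swap hG u v

theorem out_nonneg (u v : V) : 0 ≤ G.out u v := by
  rw [out_apply]; split_ifs <;> simp

theorem out_le_one (u v : V) : G.out u v ≤ 1 := by
  rw [out_apply]; split_ifs <;> simp

theorem abs_sgn_le_one (u v : V) : |G.sgn u v| ≤ 1 := by
  simp only [sgn, adjMatrix, Matrix.of_apply]; split_ifs <;> simp

theorem und_nonneg (u v : V) : 0 ≤ G.und u v := by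
  classical
  simp only [und, underlyingAdjMatrix, SimpleGraph.adjMatrix_apply]; split_ifs <;> simp

theorem und_le_one (u v : V) : G.und u v ≤ 1 := by
  classical
  simp only [und, underlyingAdjMatrix, SimpleGraph.adjMatrix_apply]; split_ifs <;> simp

theorem edgesBetween_eq_sum (A B : Finset V) :
    (G.edgesBetween A B : ℝ) = ∑ u ∈ A, ∑ v ∈ B, G.out u v := by
  classical
  rw [edgesBetween, ← Finset.sum_product', Finset.card_filter]
  push_cast
  rfl

/-- The sum of the entries of `A(G)` over `A × B` is `e(A, B) - e(B, A)`. -/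
theorem edgesBetween_sub_eq_sum (hG : G.IsOriented) (A B : Finset V) :
    (G.edgesBetween A B : ℝ) - G.edgesBetween B A = ∑ u ∈ A, ∑ v ∈ B, G.sgn u v := by
  rw [edgesBetween_eq_sum, edgesBetween_eq_sum, Finset.sum_comm (s := B), ← Finset.sum_sub_distrib]
  refine Finset.sum_congr rfl fun u _ => ?_
  rw [← Finset.sum_sub_distrib]
  exact Finset.sum_congr rfl fun v _ => (sgn_apply_eq hG u v).symm

end Basic

/-! ### Comparing τ, τ*, the cut norm and the bias. -/

section Fintype

variable {V : Type*} [Fintype V] {G : Digraph V}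

theorem numEdges_eq_sum (G : Digraph V) : (G.numEdges : ℝ) = ∑ u, ∑ v, G.out u v := by
  classical
  rw [numEdges, Nat.card_eq_fintype_card, Fintype.card_subtype, ← Finset.sum_product',
    Finset.card_filter]
  push_cast
  rfl

theorem two_mul_numEdges_eq_sum (hG : G.IsOriented) :
    2 * (G.numEdges : ℝ) = ∑ u, ∑ v, G.und u v := by
  simp_rw [und_apply_eq hG, Finset.sum_add_distrib]
  rw [Finset.sum_comm (f := fun u v => G.out v u), ← numEdges_eq_sum]
  ring

theorem numEdges_le (G : Digraph V) : (G.numEdges : ℝ) ≤ (Fintype.card V : ℝ) ^ 2 := by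
  rw [numEdges_eq_sum]
  calc ∑ u, ∑ v, G.out u v ≤ ∑ _u : V, ∑ _v : V, (1 : ℝ) :=
        Finset.sum_le_sum fun u _ => Finset.sum_le_sum fun v _ => out_le_one u v
    _ = _ := by simp [sq]

theorem edgesBetween_le_numEdges (A B : Finset V) :
    (G.edgesBetween A B : ℝ) ≤ G.numEdges := by
  rw [edgesBetween_eq_sum, numEdges_eq_sum]
  calc ∑ u ∈ A, ∑ v ∈ B, G.out u v ≤ ∑ u ∈ A, ∑ v, G.out u v :=
        Finset.sum_le_sum fun u _ => Finset.sum_le_sum_of_subset_of_nonneg (Finset.subset_univ _)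
          fun v _ _ => out_nonneg u v
    _ ≤ _ := Finset.sum_le_sum_of_subset_of_nonneg (Finset.subset_univ _)
          fun u _ _ => Finset.sum_nonneg fun v _ => out_nonneg u v

theorem le_tau (A B : Finset V) :
    (G.edgesBetween A B : ℝ) - G.edgesBetween B A ≤ G.tau :=
  le_ciSup (f := fun p : Finset V × Finset V =>
    ((G.edgesBetween p.1 p.2 : ℝ) - G.edgesBetween p.2 p.1)) (Set.finite_range _).bddAbove (A, B)

theorem tau_le {c : ℝ}
    (h : ∀ A B : Finset V, (G.edgesBetween A B : ℝ) - G.edgesBetween B A ≤ c) : G.tau ≤ c :=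
  ciSup_le fun p => h p.1 p.2

theorem le_tauStar {A B : Finset V} (h : Disjoint A B) :
    (G.edgesBetween A B : ℝ) - G.edgesBetween B A ≤ G.tauStar :=
  le_ciSup (f := fun p : {p : Finset V × Finset V // Disjoint p.1 p.2} =>
    ((G.edgesBetween p.1.1 p.1.2 : ℝ) - G.edgesBetween p.1.2 p.1.1))
    (Set.finite_range _).bddAbove ⟨(A, B), h⟩

theorem tauStar_le {c : ℝ}
    (h : ∀ A B : Finset V, Disjoint A B → (G.edgesBetween A B : ℝ) - G.edgesBetween B A ≤ c) :
    G.tauStar ≤ c := by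
  have : Nonempty {p : Finset V × Finset V // Disjoint p.1 p.2} := ⟨⟨(∅, ∅), by simp⟩⟩
  exact ciSup_le fun p => h p.1.1 p.1.2 p.2

theorem le_bias {δ : ℝ} {A B : Finset V}
    (h : (G.edgesBetween B A : ℝ) ≤ δ * G.edgesBetween A B) :
    (G.edgesBetween A B : ℝ) ≤ G.bias δ :=
  le_ciSup (f := fun p : {p : Finset V × Finset V //
      (G.edgesBetween p.2 p.1 : ℝ) ≤ δ * G.edgesBetween p.1 p.2} =>
    (G.edgesBetween p.1.1 p.1.2 : ℝ)) (Set.finite_range _).bddAbove ⟨(A, B), h⟩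

theorem bias_le {δ c : ℝ} (h : ∀ A B : Finset V,
    (G.edgesBetween B A : ℝ) ≤ δ * G.edgesBetween A B → (G.edgesBetween A B : ℝ) ≤ c) :
    G.bias δ ≤ c := by
  have : Nonempty {p : Finset V × Finset V //
      (G.edgesBetween p.2 p.1 : ℝ) ≤ δ * G.edgesBetween p.1 p.2} :=
    ⟨⟨(∅, ∅), by simp [edgesBetween]⟩⟩
  exact ciSup_le fun p => h p.1.1 p.1.2 p.2

theorem tau_nonneg (G : Digraph V) : 0 ≤ G.tau := by
  simpa using le_tau (G := G) ∅ ∅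

theorem tauStar_nonneg (G : Digraph V) : 0 ≤ G.tauStar := by
  simpa using le_tauStar (G := G) (Finset.disjoint_empty_left ∅)

theorem bias_nonneg (G : Digraph V) (δ : ℝ) : 0 ≤ G.bias δ :=
  (Nat.cast_nonneg (G.edgesBetween ∅ ∅)).trans (le_bias (by simp [edgesBetween]))

theorem tauStar_le_tau (G : Digraph V) : G.tauStar ≤ G.tau := tauStar_le fun A B _ => le_tau A B

theorem sum_sgn_le_tau (hG : G.IsOriented) (A B : Finset V) :
    ∑ u ∈ A, ∑ v ∈ B, G.sgn u v ≤ G.tau :=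
  (edgesBetween_sub_eq_sum hG A B).symm.trans_le (le_tau A B)

theorem abs_sum_sgn_le_tau (hG : G.IsOriented) (A B : Finset V) :
    |∑ u ∈ A, ∑ v ∈ B, G.sgn u v| ≤ G.tau := by
  refine abs_le'.2 ⟨sum_sgn_le_tau hG A B, ?_⟩
  rw [← edgesBetween_sub_eq_sum hG A B, neg_sub]
  exact le_tau B A

/-- A × B splits into three products of disjoint sets and the square of A ∩ B, on which the
skew-symmetric sum vanishes. -/
theorem tau_le_three_mul_tauStar (hG : G.IsOriented) : G.tau ≤ 3 * G.tauStar := by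
  classical
  refine tau_le fun A B => ?_
  have hd : ∀ {P Q : Finset V}, Disjoint P Q →
      ∑ u ∈ P, ∑ v ∈ Q, G.sgn u v ≤ G.tauStar := fun {P Q} h =>
    (edgesBetween_sub_eq_sum hG P Q).symm.trans_le (le_tauStar h)
  have h0 : ∀ C : Finset V, ∑ u ∈ C, ∑ v ∈ C, G.sgn u v = 0 := fun C => by
    rw [← edgesBetween_sub_eq_sum hG, sub_self]
  rw [edgesBetween_sub_eq_sum hG]
  have e1 : ∀ u, ∑ v ∈ B, G.sgn u v
      = ∑ v ∈ B \ A, G.sgn u v + ∑ v ∈ B ∩ A, G.sgn u v := fun u => by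
    rw [add_comm, Finset.sum_inter_add_sum_sdiff]
  have e2 : ∀ f : V → ℝ, ∑ u ∈ A, f u = ∑ u ∈ A \ B, f u + ∑ u ∈ B ∩ A, f u := fun f => by
    rw [add_comm, Finset.inter_comm, Finset.sum_inter_add_sum_sdiff]
  simp_rw [e1, Finset.sum_add_distrib]
  rw [e2, e2 (fun u => ∑ v ∈ B ∩ A, G.sgn u v), h0]
  have d1 := hd (P := A \ B) (Q := B \ A) (disjoint_sdiff_sdiff)
  have d2 := hd (P := B ∩ A) (Q := B \ A) (by
    rw [Finset.disjoint_left]; intro x; simp; tauto)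
  have d3 := hd (P := A \ B) (Q := B ∩ A) (by
    rw [Finset.disjoint_left]; intro x; simp; tauto)
  linarith

/-- The bilinear form of `A(G)` on vectors with entries in `[-1, 1]` is at most `4 τ(G)`. -/
theorem abs_sum_mul_sum_mul_le (hG : G.IsOriented) {f g : V → ℝ} (hf : ∀ u, |f u| ≤ 1)
    (hg : ∀ u, |g u| ≤ 1) :
    |∑ u, ∑ v, f u * G.sgn u v * g v| ≤ 4 * G.tau := by
  classical
  -- The sets where h is nonnegative and negative. Each of the two variables of the bilinear form is
  -- split this way once, which costs 2 · 2 = 4.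
  have key : ∀ h : V → ℝ, ∃ P Q : Finset V, ∑ u, |h u| = ∑ u ∈ P, h u - ∑ u ∈ Q, h u := by
    intro h
    refine ⟨Finset.univ.filter fun u => 0 ≤ h u, Finset.univ.filter fun u => ¬ 0 ≤ h u, ?_⟩
    rw [← Finset.sum_filter_add_sum_filter_not Finset.univ (fun u => 0 ≤ h u),
      sub_eq_add_neg, ← Finset.sum_neg_distrib]
    congr 1
    · exact Finset.sum_congr rfl fun u hu => abs_of_nonneg (Finset.mem_filter.1 hu).2
    · exact Finset.sum_congr rfl fun u hu => abs_of_neg (not_le.1 (Finset.mem_filter.1 hu).2)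
  have habs : ∀ {f h : V → ℝ}, (∀ u, |f u| ≤ 1) → |∑ u, f u * h u| ≤ ∑ u, |h u| := by
    intro f h hf
    refine (Finset.abs_sum_le_sum_abs _ _).trans (Finset.sum_le_sum fun u _ => ?_)
    rw [abs_mul]
    exact mul_le_of_le_one_left (abs_nonneg _) (hf u)
  have hcol : ∀ P : Finset V, |∑ u ∈ P, ∑ v, G.sgn u v * g v| ≤ 2 * G.tau := by
    intro P
    have : ∑ u ∈ P, ∑ v, G.sgn u v * g v = ∑ v, g v * ∑ u ∈ P, G.sgn u v := by
      rw [Finset.sum_comm]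
      refine Finset.sum_congr rfl fun v _ => ?_
      rw [Finset.mul_sum]
      exact Finset.sum_congr rfl fun u _ => mul_comm _ _
    rw [this]
    refine (habs hg).trans ?_
    obtain ⟨Q, R, h⟩ := key fun v => ∑ u ∈ P, G.sgn u v
    rw [h, Finset.sum_comm, Finset.sum_comm (s := R)]
    have h1 := abs_le.1 (abs_sum_sgn_le_tau hG P Q)
    have h2 := abs_le.1 (abs_sum_sgn_le_tau hG P R)
    linarith [h1.2, h2.1]
  have : ∑ u, ∑ v, f u * G.sgn u v * g v = ∑ u, f u * ∑ v, G.sgn u v * g v := by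
    simp_rw [Finset.mul_sum, mul_assoc]
  rw [this]
  refine (habs hf).trans ?_
  obtain ⟨Q, R, h⟩ := key fun u => ∑ v, G.sgn u v * g v
  rw [h]
  have h1 := abs_le.1 (hcol Q)
  have h2 := abs_le.1 (hcol R)
  linarith [h1.2, h2.1]

theorem bias_le_tau_div {δ : ℝ} (hδ : δ < 1) : G.bias δ ≤ G.tau / (1 - δ) := by
  refine bias_le fun A B h => ?_
  rw [le_div_iff₀ (by linarith)]
  have := le_tau (G := G) A B
  linarith

/-- A pair violating the bias condition has e(A, B) - e(B, A) < (1 - δ) e(A, B), which is at most (1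
- δ) m. -/
theorem tau_le_bias_add {δ : ℝ} (hδ : δ < 1) :
    G.tau ≤ G.bias δ + (1 - δ) * G.numEdges := by
  refine tau_le fun A B => ?_
  have h1 : (0 : ℝ) ≤ (1 - δ) * G.numEdges := mul_nonneg (by linarith) (Nat.cast_nonneg _)
  have h2 := bias_nonneg G δ
  have h3 : (0 : ℝ) ≤ G.edgesBetween B A := Nat.cast_nonneg _
  by_cases h : (G.edgesBetween B A : ℝ) ≤ δ * G.edgesBetween A B
  · have := le_bias h
    linarith
  · have := mul_le_mul_of_nonneg_left (edgesBetween_le_numEdges (G := G) A B)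
      (sub_nonneg.2 hδ.le)
    linarith

end Fintype

/-! ### Feedback arc sets, linear orders and the surplus. -/

section Surplus

variable {V : Type*}

/-- Bridges the transitive closure, suited to order extension, and the indexed cycles that define
`IsAcyclic`. -/
theorem exists_path_of_transGen {r : V → V → Prop} {u w : V} (h : Relation.TransGen r u w) :
    ∃ (l : ℕ) (p : ℕ → V), 0 < l ∧ p 0 = u ∧ p l = w ∧ ∀ i < l, r (p i) (p (i + 1)) := by
  induction h with
  | @single b h =>
    exact ⟨1, fun i => if i = 0 then u else b, one_pos, by simp, by simp, fun i hi => by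
      obtain rfl : i = 0 := by omega
      simpa using h⟩
  | @tail b c _ h ih =>
    obtain ⟨l, p, hl, h0, h1, h2⟩ := ih
    refine ⟨l + 1, fun i => if i ≤ l then p i else c, by omega, by simp [h0], by simp,
      fun i hi => ?_⟩
    rcases Nat.lt_or_ge i l with h' | h'
    · simpa [h'.le, Nat.succ_le_of_lt h'] using h2 i h'
    · obtain rfl : i = l := by omega
      simpa [h1] using h

theorem IsAcyclic.not_transGen {H : Digraph V} (hH : H.IsAcyclic) (u : V) :
    ¬ Relation.TransGen H.Adj u u := by
  intro h
  obtain ⟨l, p, hl, h0, h1, h2⟩ := exists_path_of_transGen h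
  obtain ⟨l, rfl⟩ : ∃ l', l = l' + 1 := ⟨l - 1, by omega⟩
  refine hH (l + 1) hl (fun i => p i) fun i => ?_
  rcases Nat.lt_or_ge i.val l with hi | hi
  · have : ((finRotate (l + 1) i : Fin (l + 1)) : ℕ) = i + 1 := by
      rw [show i = ⟨i.val, by omega⟩ from rfl, finRotate_of_lt hi]
    rw [this]
    exact h2 i i.2
  · have hi' : i = Fin.last l := by ext; simp; omega
    have h3 := h2 l (by omega)
    rw [h1, ← h0] at h3
    rw [hi', finRotate_last]
    simpa using h3

/-- A function increasing along the edges certifies acyclicity. -/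
theorem isAcyclic_of_lt {H : Digraph V} (k : V → ℕ) (hk : ∀ u v, H.Adj u v → k u < k v) :
    H.IsAcyclic := by
  intro r hr v h
  have : Nonempty (Fin r) := ⟨⟨0, hr⟩⟩
  obtain ⟨i, hi⟩ := Finite.exists_max fun i => k (v i)
  exact absurd (hk _ _ (h i)) (not_lt.2 (hi _))

variable [Fintype V]

/-- Topological sorting of a finite acyclic digraph. -/
theorem IsAcyclic.exists_injective_lt {H : Digraph V} (hH : H.IsAcyclic) :
    ∃ k : V → ℕ, Function.Injective k ∧ (∀ u, k u ≤ Fintype.card V) ∧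
      ∀ u v, H.Adj u v → k u < k v := by
  classical
  -- Acyclicity is what makes reachability antisymmetric. The rank is the size of the down-set in a
  -- linear extension; it runs from 1 to n, whence the non-strict bound.
  have : IsPartialOrder V (Relation.ReflTransGen H.Adj) :=
    { refl := fun a => Relation.ReflTransGen.refl
      trans := fun _ _ _ h h' => h.trans h'
      antisymm := fun a b h h' => by
        rcases Relation.reflTransGen_iff_eq_or_transGen.1 h with h1 | h1
        · exact h1.symm
        · exact (hH.not_transGen a (h1.trans_left h')).elim }
  obtain ⟨s, hs, hle⟩ := extend_partialOrder (Relation.ReflTransGen H.Adj)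
  have hlt : ∀ u v, s u v → u ≠ v →
      (Finset.univ.filter fun w => s w u).card < (Finset.univ.filter fun w => s w v).card := by
    intro u v huv hne
    refine Finset.card_lt_card ⟨fun w hw => ?_, fun h => ?_⟩
    · simp only [Finset.mem_filter, Finset.mem_univ, true_and] at hw ⊢
      exact hs.trans _ _ _ hw huv
    · have : v ∈ Finset.univ.filter fun w => s w u := h (by simpa using hs.refl v)
      exact hne (hs.antisymm _ _ huv (by simpa using this))
  refine ⟨fun u => (Finset.univ.filter fun w => s w u).card, ?_, fun u => Finset.card_le_univ _, ?_⟩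
  · intro u v h
    by_contra hne
    rcases hs.total u v with h' | h'
    · exact (hlt u v h' hne).ne h
    · exact (hlt v u h' (Ne.symm hne)).ne h.symm
  · intro u v h
    refine hlt u v (hle _ _ (Relation.ReflTransGen.single h)) ?_
    rintro rfl
    exact hH.not_transGen u (Relation.TransGen.single h)

variable {G : Digraph V}

theorem sum_symm_mul_sgn_eq_zero (hG : G.IsOriented) {c : V → V → ℝ}
    (hc : ∀ u v, c u v = c v u) : ∑ u, ∑ v, c u v * G.sgn u v = 0 := by
  have : ∑ u, ∑ v, c u v * G.sgn u v = - ∑ u, ∑ v, c u v * G.sgn u v := by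
    conv_lhs => rw [Finset.sum_comm]
    simp_rw [← Finset.sum_neg_distrib]
    refine Finset.sum_congr rfl fun u _ => Finset.sum_congr rfl fun v _ => ?_
    rw [sgn_swap hG u v, hc]
    ring
  linarith

/-- Forward minus backward edges with respect to a rank function. -/
noncomputable def forward (G : Digraph V) (k : V → ℕ) : ℝ :=
  ∑ u, ∑ v, (if k u < k v then 1 else 0) * G.sgn u v

open Classical in
/-- The edges along which `k` does not increase. -/
noncomputable def backEdges (G : Digraph V) (k : V → ℕ) : Finset (V × V) :=
  Finset.univ.filter fun p => G.Adj p.1 p.2 ∧ ¬ k p.1 < k p.2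

theorem mem_backEdges {k : V → ℕ} {p : V × V} :
    p ∈ G.backEdges k ↔ G.Adj p.1 p.2 ∧ ¬ k p.1 < k p.2 := by
  simp [backEdges]

theorem isFeedbackArcSet_backEdges (k : V → ℕ) : G.IsFeedbackArcSet (G.backEdges k) := by
  refine ⟨fun p hp => ?_, isAcyclic_of_lt k fun u v h => ?_⟩
  · exact (mem_backEdges.1 hp).1
  · by_contra hlt
    exact h.2 (mem_backEdges.2 ⟨h.1, hlt⟩)

/-- Injectivity of k makes every edge strictly forward or strictly backward. Consequently 2π is the
maximum of `forward` over linear orders. -/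
theorem numEdges_sub_two_mul_card_backEdges (hG : G.IsOriented) {k : V → ℕ}
    (hk : Function.Injective k) :
    (G.numEdges : ℝ) - 2 * (G.backEdges k).card = G.forward k := by
  classical
  have h1 : ((G.backEdges k).card : ℝ) = ∑ u, ∑ v, (if k v < k u then 1 else 0) * G.out u v := by
    rw [backEdges, Finset.card_filter, ← Finset.sum_product']
    push_cast
    refine Finset.sum_congr rfl fun p _ => ?_
    rw [out]
    by_cases h : G.Adj p.1 p.2
    · have hne : k p.1 ≠ k p.2 := fun e => by
        have := hk e
        rw [this] at h
        exact hG _ _ h h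
      have : (¬ k p.1 < k p.2) ↔ k p.2 < k p.1 := by omega
      simp [h, ← this]
    · simp [h]
  have h2 : (G.numEdges : ℝ) = ∑ u, ∑ v, (if k u < k v then 1 else 0) * G.out u v
      + ∑ u, ∑ v, (if k v < k u then 1 else 0) * G.out u v := by
    rw [numEdges_eq_sum, ← Finset.sum_add_distrib]
    refine Finset.sum_congr rfl fun u _ => ?_
    rw [← Finset.sum_add_distrib]
    refine Finset.sum_congr rfl fun v _ => ?_
    rcases lt_trichotomy (k u) (k v) with h | h | h
    · simp [h, h.le]
    · obtain rfl := hk h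
      have : ¬ G.Adj u u := fun h' => hG _ _ h' h'
      simp [out, this]
    · simp [h, h.le]
  have h3 : G.forward k = ∑ u, ∑ v, (if k u < k v then 1 else 0) * G.out u v
      - ∑ u, ∑ v, (if k v < k u then 1 else 0) * G.out u v := by
    rw [Finset.sum_comm (f := fun u v => (if k v < k u then (1 : ℝ) else 0) * G.out u v),
      ← Finset.sum_sub_distrib]
    refine Finset.sum_congr rfl fun u _ => ?_
    rw [← Finset.sum_sub_distrib]
    refine Finset.sum_congr rfl fun v _ => ?_
    rw [sgn_apply_eq hG]
    ring
  rw [h3, h2, h1]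
  ring

theorem forward_le_two_mul_surplus (hG : G.IsOriented) {k : V → ℕ} (hk : Function.Injective k) :
    G.forward k ≤ 2 * G.surplus := by
  have h : G.beta ≤ (G.backEdges k).card :=
    Nat.sInf_le ⟨_, isFeedbackArcSet_backEdges k, rfl⟩
  have h' : (G.beta : ℝ) ≤ (G.backEdges k).card := by exact_mod_cast h
  rw [← numEdges_sub_two_mul_card_backEdges hG hk, surplus]
  linarith

theorem exists_two_mul_surplus_le_forward (hG : G.IsOriented) :
    ∃ k : V → ℕ, Function.Injective k ∧ (∀ u, k u ≤ Fintype.card V) ∧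
      2 * G.surplus ≤ G.forward k := by
  obtain ⟨S, hS, hcard⟩ := Nat.sInf_mem (s := {k | ∃ S, G.IsFeedbackArcSet S ∧ S.card = k})
    ⟨_, _, isFeedbackArcSet_backEdges fun _ => 0, rfl⟩
  obtain ⟨k, hk, hle, hlt⟩ := hS.2.exists_injective_lt
  refine ⟨k, hk, hle, ?_⟩
  have h : (G.backEdges k).card ≤ G.beta := by
    rw [beta, ← hcard]
    refine Finset.card_le_card fun p hp => ?_
    have hp := mem_backEdges.1 hp
    by_contra hpS
    exact hp.2 (hlt _ _ ⟨hp.1, hpS⟩)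
  have h' : ((G.backEdges k).card : ℝ) ≤ G.beta := by exact_mod_cast h
  rw [← numEdges_sub_two_mul_card_backEdges hG hk, surplus]
  linarith

/-- A weak order has a linear refinement that is at least as good. -/
theorem forward_le_two_mul_surplus_of_rank (hG : G.IsOriented) (r : V → ℕ) :
    G.forward r ≤ 2 * G.surplus := by
  classical
  set n := Fintype.card V
  let e := Fintype.equivFin V
  have hinj : ∀ f : V → ℕ, Function.Injective f → (∀ u, f u < n) →
      Function.Injective (fun u => r u * n + f u) ∧
        ∀ u v, (r u * n + f u < r v * n + f v) ↔ (r u < r v ∨ (r u = r v ∧ f u < f v)) := by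
    intro f hf hfn
    have hlt : ∀ u v, r u < r v → r u * n + f u < r v * n + f v := by
      intro u v h
      have := Nat.mul_le_mul_right n (Nat.succ_le_of_lt h)
      have h1 := hfn u
      rw [Nat.succ_mul] at this
      omega
    have hiff : ∀ u v, (r u * n + f u < r v * n + f v) ↔
        (r u < r v ∨ (r u = r v ∧ f u < f v)) := by
      intro u v
      rcases lt_trichotomy (r u) (r v) with h | h | h
      · simp [h, hlt u v h]
      · simp [h]
      · have := hlt v u h
        constructor
        · intro h'; omega
        · rintro (h' | h') <;> omega
    refine ⟨fun u v h => ?_, hiff⟩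
    have h1 := (hiff u v).not.1 (by simp only at h; omega)
    have h2 := (hiff v u).not.1 (by simp only at h; omega)
    exact hf (by omega)
  -- Ties are broken by an enumeration and by its reverse. Over the two refinements together each
  -- tied pair is counted once in each direction, and skew-symmetry cancels it.
  have hf1 := hinj (fun u => e u) (fun u v h => e.injective (Fin.ext h)) fun u => (e u).2
  have hf2 := hinj (fun u => n - 1 - e u) (fun u v h => e.injective (Fin.ext (by
    have h1 := (e u).2
    have h2 := (e v).2
    simp only at h
    omega))) fun u => by
      have h1 := (e u).2
      omega
  have b1 := forward_le_two_mul_surplus hG hf1.1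
  have b2 := forward_le_two_mul_surplus hG hf2.1
  have hz := sum_symm_mul_sgn_eq_zero hG (c := fun u v => if r u = r v then (1 : ℝ) else 0)
    fun u v => by simp only [eq_comm]
  have hsum : G.forward (fun u => r u * n + e u) + G.forward (fun u => r u * n + (n - 1 - e u))
      = 2 * G.forward r + ∑ u, ∑ v, (if r u = r v then (1 : ℝ) else 0) * G.sgn u v := by
    simp only [forward, Finset.mul_sum, ← Finset.sum_add_distrib]
    refine Finset.sum_congr rfl fun u _ => Finset.sum_congr rfl fun v _ => ?_
    simp only [hf1.2, hf2.2]
    by_cases huv : u = v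
    · subst huv
      simp [sgn_self hG]
    have hne : (e u : ℕ) ≠ e v := fun h => huv (e.injective (Fin.ext h))
    have h1 := (e u).2
    have h2 := (e v).2
    rcases lt_trichotomy (r u) (r v) with h | h | h
    · simp [h, h.ne]; ring
    · rcases lt_or_gt_of_ne hne with h' | h'
      · have : ¬ (n - 1 - (e u : ℕ) < n - 1 - e v) := by omega
        simp [h, h', this]
      · have h3 : n - 1 - (e u : ℕ) < n - 1 - e v := by omega
        have h4 : ¬ (e u : ℕ) < e v := by omega
        rw [if_neg (by omega), if_pos (by omega), if_neg (by omega), if_pos h]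
        ring
    · rw [if_neg (by omega), if_neg (by omega), if_neg (by omega), if_neg (by omega)]
      ring
  linarith

/-- Add the orders A < B < rest and rest < A < B. Pairs from A to B are forward in both, while pairs
joining A ∪ B to the rest appear once in each direction and cancel. -/
theorem tauStar_le_two_mul_surplus (hG : G.IsOriented) : G.tauStar ≤ 2 * G.surplus := by
  classical
  refine tauStar_le fun A B hAB => ?_
  rw [edgesBetween_sub_eq_sum hG]
  have b1 := forward_le_two_mul_surplus_of_rank hG
    fun u => if u ∈ A then 0 else if u ∈ B then 1 else 2
  have b2 := forward_le_two_mul_surplus_of_rank hG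
    fun u => if u ∈ A then 1 else if u ∈ B then 2 else 0
  have hz := sum_symm_mul_sgn_eq_zero hG
    (c := fun u v => if (u ∈ A ∪ B ↔ v ∈ A ∪ B) then (0 : ℝ) else 1)
    fun u v => by simp only [iff_comm]
  have hsum : ∑ u ∈ A, ∑ v ∈ B, G.sgn u v
      = ∑ u, ∑ v, (if u ∈ A ∧ v ∈ B then (1 : ℝ) else 0) * G.sgn u v := by
    have hind : ∀ (S : Finset V) (f : V → ℝ), ∑ u ∈ S, f u = ∑ u, if u ∈ S then f u else 0 := by
      simp
    rw [hind]
    refine Finset.sum_congr rfl fun u _ => ?_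
    rw [hind]
    by_cases hu : u ∈ A <;> simp [hu]
  have : G.forward (fun u => if u ∈ A then 0 else if u ∈ B then 1 else 2)
      + G.forward (fun u => if u ∈ A then 1 else if u ∈ B then 2 else 0)
      = 2 * ∑ u ∈ A, ∑ v ∈ B, G.sgn u v
        + ∑ u, ∑ v, (if (u ∈ A ∪ B ↔ v ∈ A ∪ B) then (0 : ℝ) else 1) * G.sgn u v := by
    rw [hsum]
    simp only [forward, Finset.mul_sum, ← Finset.sum_add_distrib]
    refine Finset.sum_congr rfl fun u _ => Finset.sum_congr rfl fun v _ => ?_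
    have hd := Finset.disjoint_left.1 hAB
    by_cases hu : u ∈ A <;> by_cases hv : v ∈ A <;> by_cases hu' : u ∈ B <;> by_cases hv' : v ∈ B <;>
      first
      | exact (hd hu hu').elim
      | exact (hd hv hv').elim
      | (simp [hu, hv, hu', hv']; try ring)
  linarith

/-- Cutting a linear order into intervals of length `s` bounds the surplus by `τ`. -/
theorem two_mul_surplus_le (hG : G.IsOriented) {s : ℕ} (hs : 0 < s) :
    2 * G.surplus ≤ ((Fintype.card V / s : ℕ) + 1) * G.tau + Fintype.card V * s := by
  classical
  obtain ⟨k, hk, hle, hfw⟩ := exists_two_mul_surplus_le_forward hG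
  set n := Fintype.card V
  refine hfw.trans ?_
  have hsplit : G.forward k = ∑ u, ∑ v, (if k u / s < k v / s then (1 : ℝ) else 0) * G.sgn u v
      + ∑ u, ∑ v, (if k u / s = k v / s ∧ k u < k v then (1 : ℝ) else 0) * G.sgn u v := by
    simp only [forward, ← Finset.sum_add_distrib]
    refine Finset.sum_congr rfl fun u _ => Finset.sum_congr rfl fun v _ => ?_
    rw [← add_mul]
    congr 1
    by_cases h : k u < k v
    · rcases (Nat.div_le_div_right (c := s) h.le).lt_or_eq with h' | h'
      · simp [h, h', h'.ne]
      · simp [h, h']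
    · have : ¬ k u / s < k v / s := not_lt.2 (Nat.div_le_div_right (not_lt.1 h))
      simp [h, this]
  have h1 : ∑ u, ∑ v, (if k u / s < k v / s then (1 : ℝ) else 0) * G.sgn u v
      ≤ ((n / s : ℕ) + 1) * G.tau := by
    -- Ranks run up to n inclusive, hence n/s + 1 intervals. The pairs from one interval to all
    -- later ones form a single product of sets and contribute at most τ.
    have hmaps : ∀ u ∈ (Finset.univ : Finset V), k u / s ∈ Finset.range (n / s + 1) := fun u _ =>
      Finset.mem_range.2 (Nat.lt_succ_of_le (Nat.div_le_div_right (hle u)))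
    rw [← Finset.sum_fiberwise_of_maps_to hmaps]
    calc _ ≤ ∑ _p ∈ Finset.range (n / s + 1), G.tau := by
          refine Finset.sum_le_sum fun p _ => ?_
          refine le_trans (le_of_eq ?_) (sum_sgn_le_tau hG
            (Finset.univ.filter fun u => k u / s = p) (Finset.univ.filter fun v => p < k v / s))
          refine Finset.sum_congr rfl fun u hu => ?_
          rw [Finset.sum_filter]
          refine Finset.sum_congr rfl fun v _ => ?_
          rw [(Finset.mem_filter.1 hu).2, ite_mul, one_mul, zero_mul]
      _ = _ := by simp
  have h2 : ∑ u, ∑ v, (if k u / s = k v / s ∧ k u < k v then (1 : ℝ) else 0) * G.sgn u v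
      ≤ n * s := by
    -- Pairs inside an interval are bounded trivially: a vertex shares its interval with at most s
    -- vertices, itself included.
    calc _ ≤ ∑ _u : V, (s : ℝ) := by
          refine Finset.sum_le_sum fun u _ => ?_
          calc _ ≤ ∑ v, (if k v / s = k u / s then (1 : ℝ) else 0) := by
                refine Finset.sum_le_sum fun v _ => ?_
                by_cases h : k u / s = k v / s
                · have hb := (abs_le.1 (abs_sgn_le_one (G := G) u v)).2
                  by_cases h' : k u < k v <;> simp [h, h', hb]
                · simp [h, Ne.symm h]
            _ = ((Finset.univ.filter fun v => k v / s = k u / s).card : ℝ) := by simp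
            _ ≤ s := by
                have : (Finset.univ.filter fun v => k v / s = k u / s).card
                    ≤ (Finset.Ico (k u / s * s) (k u / s * s + s)).card := by
                  refine Finset.card_le_card_of_injOn k (fun v hv => ?_) hk.injOn
                  have hv := (Finset.mem_filter.1 (Finset.mem_coe.1 hv)).2
                  have e1 := Nat.div_mul_le_self (k v) s
                  have e2 := Nat.lt_div_mul_add (a := k v) hs
                  rw [hv] at e1 e2
                  simpa using ⟨e1, e2⟩
                rw [Nat.card_Ico, Nat.add_sub_cancel_left] at this
                exact_mod_cast this
      _ = _ := by simp [n]
  rw [hsplit]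
  linarith

end Surplus

/-! ### Counting lemma and lower bounds for bipartite homomorphisms. -/

section Counting

variable {V W : Type*} [Fintype V] [Fintype W] [DecidableEq W]

theorem sum_sum_update (F : (W → V) → ℝ) (a : W) :
    ∑ f : W → V, ∑ x, F (Function.update f a x) = Fintype.card V * ∑ f, F f := by
  -- Resampling one coordinate exchanges the old and new values, an involution on pairs.
  let e : (W → V) × V ≃ (W → V) × V :=
    Function.Involutive.toPerm (fun p => (Function.update p.1 a p.2, p.1 a)) fun p => by simp
  calc ∑ f : W → V, ∑ x, F (Function.update f a x)
      = ∑ p : (W → V) × V, F (e p).1 := by rw [Fintype.sum_prod_type]; rfl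
    _ = ∑ p : (W → V) × V, F p.1 := Equiv.sum_comp e fun p => F p.1
    _ = _ := by rw [Fintype.sum_prod_type, Finset.mul_sum]; simp

variable {G : Digraph V}

/-- A homomorphism sum in which one factor is `A(G)` is controlled by `τ(G)`. -/
theorem sq_card_mul_abs_sum_prod_le (hG : G.IsOriented) {ι : Type*} {E : Finset ι} {s t : ι → W}
    {q : ι} (hq : q ∈ E) (hst : s q ≠ t q)
    (hE : ∀ r ∈ E, r ≠ q → ¬ ((s r = s q ∨ t r = s q) ∧ (s r = t q ∨ t r = t q)))
    {w : ι → V → V → ℝ} (hw : ∀ r u v, |w r u v| ≤ 1) (hwq : w q = G.sgn) :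
    (Fintype.card V : ℝ) ^ 2 * |∑ f : W → V, ∏ r ∈ E, w r (f (s r)) (f (t r))|
      ≤ 4 * G.tau * (Fintype.card V : ℝ) ^ Fintype.card W := by
  classical
  set Φ : Finset ι → (W → V) → ℝ := fun p f => ∏ r ∈ p, w r (f (s r)) (f (t r)) with hΦ
  have hΦ1 : ∀ p f, |Φ p f| ≤ 1 := fun p f => by
    rw [hΦ, Finset.abs_prod]
    exact Finset.prod_le_one (fun _ _ => abs_nonneg _) fun r _ => hw r _ _
  -- Factors in P involve t q and hence, by `hE`, not s q; factors in P' avoid t q. After both ends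
  -- of q are resampled as x and y, the product is therefore Φ P' (depending on x) times `G.sgn x y`
  -- times Φ P (depending on y), a bilinear form for each frozen f. The factor n² in the statement
  -- pays for the resampling.
  set P : Finset ι := (E.erase q).filter fun r => s r = t q ∨ t r = t q with hP
  set P' : Finset ι := (E.erase q).filter fun r => ¬ (s r = t q ∨ t r = t q) with hP'
  have hF : ∀ f : W → V, ∏ r ∈ E, w r (f (s r)) (f (t r))
      = G.sgn (f (s q)) (f (t q)) * (Φ P f * Φ P' f) := fun f => by
    rw [← Finset.mul_prod_erase E _ hq, hwq, hΦ]
    simp only [hP, hP']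
    rw [Finset.prod_filter_mul_prod_filter_not]
  have hup : ∀ (f : W → V) x y,
      ∏ r ∈ E, w r (Function.update (Function.update f (s q) x) (t q) y (s r))
        (Function.update (Function.update f (s q) x) (t q) y (t r))
      = Φ P' (Function.update f (s q) x) * G.sgn x y
          * Φ P (Function.update f (t q) y) := by
    intro f x y
    rw [hF]
    have h1 : Φ P' (Function.update (Function.update f (s q) x) (t q) y)
        = Φ P' (Function.update f (s q) x) := by
      refine Finset.prod_congr rfl fun r hr => ?_
      have hr := (Finset.mem_filter.1 hr).2
      simp only [not_or] at hr
      rw [Function.update_of_ne hr.1, Function.update_of_ne hr.2]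
    have h2 : Φ P (Function.update (Function.update f (s q) x) (t q) y)
        = Φ P (Function.update f (t q) y) := by
      rw [Function.update_comm hst]
      refine Finset.prod_congr rfl fun r hr => ?_
      obtain ⟨hr1, hr2⟩ := Finset.mem_filter.1 hr
      have h := hE r (Finset.mem_of_mem_erase hr1) (Finset.ne_of_mem_erase hr1)
      have h3 : ¬ (s r = s q ∨ t r = s q) := fun h' => h ⟨h', hr2⟩
      rw [not_or] at h3
      rw [Function.update_of_ne h3.1, Function.update_of_ne h3.2]
    rw [h1, h2, Function.update_self, Function.update_of_ne hst, Function.update_self]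
    ring
  have hsum : (Fintype.card V : ℝ) ^ 2 * ∑ f : W → V, ∏ r ∈ E, w r (f (s r)) (f (t r))
      = ∑ f : W → V, ∑ x, ∑ y, Φ P' (Function.update f (s q) x) * G.sgn x y
          * Φ P (Function.update f (t q) y) := by
    simp_rw [← hup]
    rw [sum_sum_update (fun g : W → V => ∑ y, ∏ r ∈ E, w r (Function.update g (t q) y (s r))
        (Function.update g (t q) y (t r))) (s q),
      sum_sum_update (fun g : W → V => ∏ r ∈ E, w r (g (s r)) (g (t r))) (t q)]
    ring
  have habs : (Fintype.card V : ℝ) ^ 2 * |∑ f : W → V, ∏ r ∈ E, w r (f (s r)) (f (t r))|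
      = |(Fintype.card V : ℝ) ^ 2 * ∑ f : W → V, ∏ r ∈ E, w r (f (s r)) (f (t r))| := by
    rw [abs_mul, abs_of_nonneg (by positivity : (0 : ℝ) ≤ (Fintype.card V : ℝ) ^ 2)]
  rw [habs, hsum]
  refine (Finset.abs_sum_le_sum_abs _ _).trans ?_
  calc _ ≤ ∑ _f : W → V, 4 * G.tau := Finset.sum_le_sum fun f _ =>
        abs_sum_mul_sum_mul_le hG (fun u => hΦ1 _ _) (fun u => hΦ1 _ _)
    _ = _ := by simp [mul_comm]

/-- Replacing the 0-1 weights of the directed edges by half of the undirected ones. -/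
theorem sq_card_mul_abs_sum_prod_out_sub_le (hG : G.IsOriented) {ι : Type*} {E : Finset ι}
    {s t : ι → W} (hst : ∀ q ∈ E, s q ≠ t q)
    (hE : ∀ q ∈ E, ∀ r ∈ E, r ≠ q →
      ¬ ((s r = s q ∨ t r = s q) ∧ (s r = t q ∨ t r = t q))) :
    (Fintype.card V : ℝ) ^ 2 * |∑ f : W → V, ∏ r ∈ E, G.out (f (s r)) (f (t r))
        - (1 / 2) ^ E.card * ∑ f : W → V, ∏ r ∈ E, G.und (f (s r)) (f (t r))|
      ≤ E.card * (4 * G.tau * (Fintype.card V : ℝ) ^ Fintype.card W) := by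
  classical
  set N := (Fintype.card V : ℝ)
  -- S records the factors already switched from half undirected to directed. Switching one more
  -- changes the product by half of one with a factor `G.sgn`; this gain of 1/2 is later discarded.
  let w : Finset ι → ι → V → V → ℝ := fun S r u v =>
    if r ∈ S then G.out u v else G.und u v / 2
  have key : ∀ S : Finset ι, S ⊆ E →
      N ^ 2 * |∑ f : W → V, ∏ r ∈ E, w S r (f (s r)) (f (t r))
        - ∑ f : W → V, ∏ r ∈ E, w ∅ r (f (s r)) (f (t r))|
      ≤ S.card * (4 * G.tau * N ^ Fintype.card W) := by
    intro S
    induction S using Finset.induction_on with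
    | empty => simp
    | insert q S hqS ih =>
      intro hsub
      have ih := ih ((Finset.subset_insert _ _).trans hsub)
      have hqE : q ∈ E := hsub (Finset.mem_insert_self _ _)
      let w' : ι → V → V → ℝ := fun r => if r = q then G.sgn else w S r
      have hw' : ∀ r u v, |w' r u v| ≤ 1 := by
        intro r u v
        have h1 := out_nonneg (G := G) u v
        have h2 := out_le_one (G := G) u v
        have h3 := und_nonneg (G := G) u v
        have h4 := und_le_one (G := G) u v
        simp only [w', w]
        split_ifs
        · exact abs_sgn_le_one u v
        · rw [abs_of_nonneg h1]; exact h2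
        · rw [abs_of_nonneg (by linarith)]; linarith
      have hL := sq_card_mul_abs_sum_prod_le hG hqE (hst q hqE) (hE q hqE) hw' (by simp [w'])
      have hdiff : ∑ f : W → V, ∏ r ∈ E, w (insert q S) r (f (s r)) (f (t r))
          - ∑ f : W → V, ∏ r ∈ E, w S r (f (s r)) (f (t r))
          = 1 / 2 * ∑ f : W → V, ∏ r ∈ E, w' r (f (s r)) (f (t r)) := by
        rw [← Finset.sum_sub_distrib, Finset.mul_sum]
        refine Finset.sum_congr rfl fun f _ => ?_
        rw [← Finset.mul_prod_erase E _ hqE, ← Finset.mul_prod_erase E _ hqE,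
          ← Finset.mul_prod_erase E (fun r => w' r (f (s r)) (f (t r))) hqE]
        have e1 : ∏ r ∈ E.erase q, w (insert q S) r (f (s r)) (f (t r))
            = ∏ r ∈ E.erase q, w S r (f (s r)) (f (t r)) :=
          Finset.prod_congr rfl fun r hr => by
            simp [w, Finset.mem_insert, Finset.ne_of_mem_erase hr]
        have e2 : ∏ r ∈ E.erase q, w' r (f (s r)) (f (t r))
            = ∏ r ∈ E.erase q, w S r (f (s r)) (f (t r)) :=
          Finset.prod_congr rfl fun r hr => by simp [w', Finset.ne_of_mem_erase hr]
        rw [e1, e2]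
        simp only [w, w', Finset.mem_insert_self, hqS, if_true, if_false]
        rw [out_apply_eq hG]
        ring
      rw [Finset.card_insert_of_notMem hqS]
      push_cast
      have h0 : 0 ≤ N ^ 2 := by positivity
      calc _ = N ^ 2 * |(∑ f : W → V, ∏ r ∈ E, w (insert q S) r (f (s r)) (f (t r))
          - ∑ f : W → V, ∏ r ∈ E, w S r (f (s r)) (f (t r)))
          + (∑ f : W → V, ∏ r ∈ E, w S r (f (s r)) (f (t r))
          - ∑ f : W → V, ∏ r ∈ E, w ∅ r (f (s r)) (f (t r)))| := by rw [sub_add_sub_cancel]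
        _ ≤ N ^ 2 * (|∑ f : W → V, ∏ r ∈ E, w' r (f (s r)) (f (t r))|
          + |∑ f : W → V, ∏ r ∈ E, w S r (f (s r)) (f (t r))
          - ∑ f : W → V, ∏ r ∈ E, w ∅ r (f (s r)) (f (t r))|) := by
            refine mul_le_mul_of_nonneg_left ((abs_add_le _ _).trans ?_) h0
            rw [hdiff, abs_mul]
            have := abs_nonneg (∑ f : W → V, ∏ r ∈ E, w' r (f (s r)) (f (t r)))
            gcongr
            rw [abs_of_pos (by norm_num)]
            linarith
        _ ≤ _ := by linarith
  have := key E subset_rfl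
  convert this using 4
  · exact Finset.sum_congr rfl fun f _ => Finset.prod_congr rfl fun r hr => by simp [w, hr]
  · rw [Finset.mul_sum]
    refine Finset.sum_congr rfl fun f _ => ?_
    rw [← Finset.prod_const, ← Finset.prod_mul_distrib]
    exact Finset.prod_congr rfl fun r hr => by simp [w]; ring

/-- Counting injective maps instead of all maps changes little. -/
theorem card_embedding_le_card_fun (Q : (W → V) → Prop) :
    Nat.card {f : W ↪ V // Q f} ≤ Nat.card {f : W → V // Q f} ∧
    Nat.card {f : W → V // Q f} ≤ Nat.card {f : W ↪ V // Q f}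
      + (Fintype.card V ^ Fintype.card W - (Fintype.card V).descFactorial (Fintype.card W)) := by
  classical
  have e1 : Nat.card {f : W ↪ V // Q f}
      = (Finset.univ.filter fun f : W → V => Q f ∧ Function.Injective f).card := by
    rw [← Fintype.card_subtype, ← Nat.card_eq_fintype_card]
    refine Nat.card_congr ⟨fun f => ⟨f.1, f.2, f.1.injective⟩, fun f => ⟨⟨f.1, f.2.2⟩, f.2.1⟩,
      fun _ => rfl, fun _ => rfl⟩
  have e2 : Nat.card {f : W → V // Q f} = (Finset.univ.filter fun f : W → V => Q f).card := by
    rw [Nat.card_eq_fintype_card, Fintype.card_subtype]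
  have e3 : (Finset.univ.filter fun f : W → V => Function.Injective f).card
      = (Fintype.card V).descFactorial (Fintype.card W) := by
    rw [← Fintype.card_embedding_eq, ← Fintype.card_subtype]
    exact Fintype.card_congr (Equiv.subtypeInjectiveEquivEmbedding W V)
  have e4 : (Finset.univ.filter fun f : W → V => Function.Injective f).card
      + (Finset.univ.filter fun f : W → V => ¬ Function.Injective f).card
      = Fintype.card V ^ Fintype.card W := by
    rw [Finset.card_filter_add_card_filter_not, Finset.card_univ, Fintype.card_fun]
  have e5 := Finset.card_filter_add_card_filter_not (s := Finset.univ.filter fun f : W → V => Q f)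
    Function.Injective
  rw [Finset.filter_filter, Finset.filter_filter] at e5
  have e6 : (Finset.univ.filter fun f : W → V => Q f ∧ ¬ Function.Injective f).card
      ≤ (Finset.univ.filter fun f : W → V => ¬ Function.Injective f).card :=
    Finset.card_le_card fun f hf => by simp at hf ⊢; exact hf.2
  omega

/-- The power-mean inequality, with a lower bound d in place of the mean. -/
theorem pow_mul_card_le_sum_pow {X : Type*} [Fintype X] {f : X → ℝ} (hf : ∀ x, 0 ≤ f x) {d : ℝ}
    (hd : 0 ≤ d) (h : d * Fintype.card X ≤ ∑ x, f x) (q : ℕ) :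
    d ^ q * Fintype.card X ≤ ∑ x, f x ^ q := by
  cases q with
  | zero => simp
  | succ q =>
    rcases isEmpty_or_nonempty X with hX | hX
    · simp
    refine le_trans ?_ (pow_sum_div_card_le_sum_pow (fun x _ => hf x) q)
    have hc : (0 : ℝ) < Fintype.card X := by exact_mod_cast Fintype.card_pos
    rw [Finset.card_univ, le_div_iff₀ (by positivity)]
    calc _ = (d * Fintype.card X) ^ (q + 1) := by ring
      _ ≤ _ := by gcongr

/-- Dense graphs contain many copies of complete bipartite graphs. -/
theorem le_sum_sum_prod {P Q : Type*} [Fintype P] [Fintype Q] [DecidableEq P] [DecidableEq Q] {M : V → V → ℝ}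
    (hM : ∀ u v, 0 ≤ M u v) {d : ℝ} (hd : 0 ≤ d)
    (h : d * (Fintype.card V : ℝ) ^ 2 ≤ ∑ u, ∑ v, M u v) :
    d ^ (Fintype.card P * Fintype.card Q) * (Fintype.card V : ℝ) ^ (Fintype.card P + Fintype.card Q)
      ≤ ∑ x : P → V, ∑ y : Q → V, ∏ a, ∏ b, M (x a) (y b) := by
  classical
  have hprod : ∀ (g : V → ℝ),
      ∑ y : Q → V, ∏ b, g (y b) = (∑ v, g v) ^ Fintype.card Q := by
    intro g
    have := Finset.prod_univ_sum (fun _ : Q => (Finset.univ : Finset V)) (fun _ v => g v)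
    rw [Fintype.piFinset_univ] at this
    rw [← this, Finset.prod_const, Finset.card_univ]
  have hprod' : ∀ (g : V → ℝ),
      ∑ y : P → V, ∏ b, g (y b) = (∑ v, g v) ^ Fintype.card P := by
    intro g
    have := Finset.prod_univ_sum (fun _ : P => (Finset.univ : Finset V)) (fun _ v => g v)
    rw [Fintype.piFinset_univ] at this
    rw [← this, Finset.prod_const, Finset.card_univ]
  -- Two convexity steps: the first, on degrees, counts stars with `Fintype.card P` leaves;
  -- regrouped by their leaves these are common neighbourhoods of P-tuples, to which the second
  -- applies.
  have h1 := pow_mul_card_le_sum_pow (f := fun v => ∑ u, M u v)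
    (fun v => Finset.sum_nonneg fun u _ => hM u v)
    (d := d * Fintype.card V) (by positivity) (by rw [Finset.sum_comm]; linarith)
    (Fintype.card P)
  have h2 := pow_mul_card_le_sum_pow (f := fun x : P → V => ∑ v, ∏ a, M (x a) v)
    (fun x => Finset.sum_nonneg fun v _ => Finset.prod_nonneg fun a _ => hM _ _)
    (d := d ^ Fintype.card P * Fintype.card V) (by positivity) (by
      rw [Finset.sum_comm]
      have h3 : ∀ v, ∑ x : P → V, ∏ a, M (x a) v = (∑ u, M u v) ^ Fintype.card P :=
        fun v => hprod' fun u => M u v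
      simp_rw [h3]
      refine le_trans (le_of_eq ?_) h1
      rw [Fintype.card_fun]
      push_cast
      ring) (Fintype.card Q)
  refine le_trans (le_of_eq ?_) (h2.trans (le_of_eq ?_))
  · rw [Fintype.card_fun]
    push_cast
    ring
  · refine Finset.sum_congr rfl fun x _ => ?_
    rw [← hprod]
    exact Finset.sum_congr rfl fun y _ => Finset.prod_comm

/-- A 2-colouring places H inside the complete bipartite graph on its colour classes, so
homomorphisms of the latter suffice. Capping the base at 1 allows the exponent |W|², which does not
depend on the class sizes. -/
theorem le_card_hom_of_colorable (hG : G.IsOriented) {H : SimpleGraph W} (hH : H.Colorable 2)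
    {c : ℝ} (hc : 0 < c) (hm : c * (Fintype.card V : ℝ) ^ 2 ≤ G.numEdges) :
    (min 1 (2 * c)) ^ (Fintype.card W ^ 2) * (Fintype.card V : ℝ) ^ Fintype.card W
      ≤ Nat.card {f : W → V // ∀ a b, H.Adj a b → G.underlying.Adj (f a) (f b)} := by
  classical
  obtain ⟨χ⟩ := hH
  have h1 := le_sum_sum_prod (P := {w // χ w = 0}) (Q := {w // ¬ χ w = 0}) (M := G.und)
    und_nonneg (d := 2 * c) (by positivity) (by rw [← two_mul_numEdges_eq_sum hG]; linarith)
  have hcard : Fintype.card {w // χ w = 0} + Fintype.card {w // ¬ χ w = 0} = Fintype.card W := by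
    rw [Fintype.card_subtype_compl]
    have := Fintype.card_subtype_le fun w => χ w = 0
    omega
  rw [hcard] at h1
  have h2 : (min 1 (2 * c)) ^ (Fintype.card W ^ 2)
      ≤ (2 * c) ^ (Fintype.card {w // χ w = 0} * Fintype.card {w // ¬ χ w = 0}) := by
    have hpos : 0 ≤ min 1 (2 * c) := le_min zero_le_one (by positivity)
    refine (pow_le_pow_of_le_one hpos (min_le_left _ _) ?_).trans
      (pow_le_pow_left₀ hpos (min_le_right _ _) _)
    rw [sq]
    exact Nat.mul_le_mul (by omega) (by omega)
  refine (mul_le_mul_of_nonneg_right h2 (by positivity)).trans (h1.trans ?_)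
  rw [← Fintype.sum_prod_type (f := fun p : ({w // χ w = 0} → V) × ({w // ¬ χ w = 0} → V) =>
    ∏ a, ∏ b, G.und (p.1 a) (p.2 b)),
    ← Equiv.sum_comp (Equiv.piEquivPiSubtypeProd (fun w => χ w = 0) fun _ => V),
    Nat.card_eq_fintype_card, Fintype.card_subtype, Finset.card_filter]
  push_cast
  refine Finset.sum_le_sum fun f _ => ?_
  split_ifs with hf
  · exact Finset.prod_le_one (fun _ _ => Finset.prod_nonneg fun _ _ => und_nonneg _ _)
      fun _ _ => Finset.prod_le_one (fun _ _ => und_nonneg _ _) fun _ _ => und_le_one _ _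
  · refine le_of_eq ?_
    by_contra hne
    refine hf ?_
    have hadj : ∀ a b, χ a = 0 → ¬ χ b = 0 → G.underlying.Adj (f a) (f b) := by
      intro a b ha hb
      have h3 := Finset.prod_ne_zero_iff.1 (Finset.prod_ne_zero_iff.1 hne ⟨a, ha⟩ (Finset.mem_univ _))
        ⟨b, hb⟩ (Finset.mem_univ _)
      by_contra hn
      refine h3 ?_
      change G.und (f a) (f b) = 0
      simp only [und, underlyingAdjMatrix, SimpleGraph.adjMatrix_apply, hn, if_false]
    intro a b hab
    have hv := χ.valid hab
    by_cases ha : χ a = 0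
    · exact hadj a b ha fun hb => hv (ha.trans hb.symm)
    · refine (hadj b a ?_ ha).symm
      have : ∀ x y : Fin 2, x ≠ y → x ≠ 0 → y = 0 := by decide
      exact this _ _ hv ha

end Counting

end Digraph

/-! ### Traces of matrix powers as sums over closed walks. -/

section Trace

variable {V : Type*} [Fintype V] [DecidableEq V]

/-- Here v lists the interior vertices of a walk from u to w; `Fin.cons` lists the tails of its
steps and `Fin.snoc` the heads. -/
theorem Matrix.pow_succ_apply_eq_sum_prod (f : V → V → ℝ) (k : ℕ)
    (u w : V) :
    (Matrix.of f ^ (k + 1)) u w = ∑ v : Fin k → V, ∏ i : Fin (k + 1),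
      f (Fin.cons (α := fun _ => V) u v i) (Fin.snoc (α := fun _ => V) v w i) := by
  induction k generalizing u with
  | zero => simp [Fin.snoc]
  | succ k ih =>
    rw [pow_succ', Matrix.mul_apply, ← Equiv.sum_comp (Fin.consEquiv fun _ : Fin (k + 1) => V),
      Fintype.sum_prod_type]
    refine Finset.sum_congr rfl fun x _ => ?_
    rw [ih, Finset.mul_sum]
    refine Finset.sum_congr rfl fun v _ => ?_
    conv_rhs => rw [Fin.prod_univ_succ]
    refine congrArg₂ (· * ·) rfl ?_
    refine Fintype.prod_congr _ _ fun i => ?_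
    rw [show Fin.consEquiv (fun _ : Fin (k + 1) => V) (x, v) = Fin.cons x v from rfl,
      Fin.cons_succ, ← Fin.cons_snoc_eq_snoc_cons, Fin.cons_succ]

/-- The trace of a power as a sum over closed walks. -/
theorem Matrix.trace_pow_eq_sum_prod (f : V → V → ℝ) {k : ℕ} (hk : 0 < k) :
    (Matrix.of f ^ k).trace = ∑ v : Fin k → V, ∏ i, f (v i) (v (finRotate k i)) := by
  obtain ⟨k, rfl⟩ : ∃ l, k = l + 1 := ⟨k - 1, by omega⟩
  rw [Matrix.trace, ← Equiv.sum_comp (Fin.consEquiv fun _ : Fin (k + 1) => V),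
    Fintype.sum_prod_type]
  refine Finset.sum_congr rfl fun u _ => ?_
  rw [Matrix.diag_apply, Matrix.pow_succ_apply_eq_sum_prod]
  refine Finset.sum_congr rfl fun v _ => ?_
  refine Finset.prod_congr rfl fun i _ => ?_
  rw [Fin.snoc_eq_cons_rotate]
  rfl

end Trace

namespace Digraph

section

theorem prod_ite_one_zero {ι : Type*} (s : Finset ι) (p : ι → Prop) [DecidablePred p]
    [Decidable (∀ i ∈ s, p i)] :
    ∏ i ∈ s, (if p i then (1 : ℝ) else 0) = if ∀ i ∈ s, p i then 1 else 0 := by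
  split_ifs with h
  · exact Finset.prod_eq_one fun i hi => if_pos (h i hi)
  · push Not at h
    obtain ⟨i, hi, hp⟩ := h
    exact Finset.prod_eq_zero hi (if_neg hp)

open Classical in
theorem und_eq_ite {V : Type*} {G : Digraph V} (u v : V) :
    G.und u v = if G.underlying.Adj u v then 1 else 0 := by
  simp only [und, underlyingAdjMatrix, SimpleGraph.adjMatrix_apply]

theorem labelledCopyCount_eq_card {V W : Type*} [Fintype V] [Fintype W] (H : SimpleGraph W)
    (K : SimpleGraph V) :
    K.labelledCopyCount H = Nat.card {f : W ↪ V // ∀ a b, H.Adj a b → K.Adj (f a) (f b)} := by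
  classical
  rw [SimpleGraph.labelledCopyCount, ← Nat.card_eq_fintype_card]
  exact Nat.card_congr ⟨fun f => ⟨⟨f.toHom, f.injective⟩, fun a b h => f.toHom.map_rel h⟩,
    fun f => ⟨⟨f.1, fun {a b} h => f.2 a b h⟩, f.1.injective⟩, fun _ => rfl, fun _ => rfl⟩

variable {V : Type*} [Fintype V] [DecidableEq V] {G : Digraph V}

theorem trace_adjMatrix_pow (G : Digraph V) {k : ℕ} (hk : 0 < k) :
    (G.adjMatrix ^ k).trace = ∑ v : Fin k → V, ∏ i, G.sgn (v i) (v (finRotate k i)) :=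
  Matrix.trace_pow_eq_sum_prod G.sgn hk

theorem trace_underlyingAdjMatrix_pow (G : Digraph V) {k : ℕ} (hk : 0 < k) :
    (G.underlyingAdjMatrix ^ k).trace = ∑ v : Fin k → V, ∏ i, G.und (v i) (v (finRotate k i)) :=
  Matrix.trace_pow_eq_sum_prod G.und hk

/-- The counting lemma for the step from position 0 to position 1. Length at least 3 is needed: in a
closed walk of length 2 both steps join the same two positions. -/
theorem sq_card_mul_abs_trace_le (hG : G.IsOriented) {k : ℕ} (hk : 3 ≤ k) :
    (Fintype.card V : ℝ) ^ 2 * |(G.adjMatrix ^ k).trace|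
      ≤ 4 * G.tau * (Fintype.card V : ℝ) ^ k := by
  rw [trace_adjMatrix_pow G (by omega)]
  obtain ⟨k, rfl⟩ : ∃ l, k = l + 3 := ⟨k - 3, by omega⟩
  have h := sq_card_mul_abs_sum_prod_le hG (E := (Finset.univ : Finset (Fin (k + 3))))
    (s := id) (t := finRotate (k + 3)) (q := 0) (Finset.mem_univ _)
    (w := fun _ => G.sgn) (by simp) (fun r _ hr => by
      simp only [id, finRotate_apply, zero_add]
      rintro ⟨h1 | h1, h2 | h2⟩
      · exact hr h1
      · exact hr h1
      · have : r.val + 1 < k + 3 := by rw [h2]; simp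
        rw [h2] at h1
        simp only [Fin.ext_iff, Fin.val_add, Fin.val_one, Fin.val_zero] at h1
        rw [Nat.mod_eq_of_lt (by omega)] at h1
        omega
      · rw [h1] at h2
        simp at h2)
    (fun _ u v => abs_sgn_le_one u v) rfl
  simpa using h

theorem trace_underlyingAdjMatrix_pow_eq_card (G : Digraph V) {k : ℕ} (hk : 2 ≤ k) :
    (G.underlyingAdjMatrix ^ k).trace = Nat.card {f : Fin k → V //
      ∀ a b, (SimpleGraph.cycleGraph k).Adj a b → G.underlying.Adj (f a) (f b)} := by
  classical
  rw [trace_underlyingAdjMatrix_pow G (by omega), Nat.card_eq_fintype_card, Fintype.card_subtype,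
    Finset.card_filter]
  push_cast
  refine Finset.sum_congr rfl fun f _ => ?_
  simp_rw [und_eq_ite]
  rw [prod_ite_one_zero]
  refine if_congr ?_ rfl rfl
  obtain ⟨k, rfl⟩ : ∃ l, k = l + 2 := ⟨k - 2, by omega⟩
  simp only [Finset.mem_univ, true_imp_iff, SimpleGraph.cycleGraph_adj, finRotate_apply]
  constructor
  · rintro h a b (hab | hab)
    · have := h b
      rw [← hab, add_sub_cancel] at this
      exact this.symm
    · have := h a
      rwa [← hab, add_sub_cancel] at this
  · intro h i
    exact h _ _ (Or.inr (by simp))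

/-- On a closed walk of the underlying graph the unsigned product is 1 and the signed one is (-1) to
the number of backward steps, so their sum is 2 or 0. -/
theorem two_mul_evenSwitchCount (hG : G.IsOriented) {k : ℕ} (hk : 0 < k) :
    2 * (G.evenSwitchCount k : ℝ)
      = (G.underlyingAdjMatrix ^ k).trace + (G.adjMatrix ^ k).trace := by
  classical
  rw [trace_underlyingAdjMatrix_pow G hk, trace_adjMatrix_pow G hk, evenSwitchCount,
    Nat.card_eq_fintype_card, Fintype.card_subtype, Finset.card_filter, ← Finset.sum_add_distrib]
  push_cast
  rw [Finset.mul_sum]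
  refine Finset.sum_congr rfl fun v _ => ?_
  by_cases h : ∀ i, Xor (G.Adj (v i) (v (finRotate k i))) (G.Adj (v (finRotate k i)) (v i))
  · have h1 : ∏ i, G.und (v i) (v (finRotate k i)) = 1 := Finset.prod_eq_one fun i _ => by
      rw [und_eq_ite, if_pos]
      exact (underlying_adj hG _ _).2 ((h i).imp And.left And.left)
    have h2 : ∏ i, G.sgn (v i) (v (finRotate k i))
        = (-1) ^ (Finset.univ.filter fun i => G.Adj (v (finRotate k i)) (v i)).card := by
      rw [← Finset.prod_const, Finset.prod_filter]
      refine Finset.prod_congr rfl fun i _ => ?_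
      rw [sgn_apply_eq hG, out_apply, out_apply]
      rcases h i with ⟨ha, hb⟩ | ⟨ha, hb⟩
      · rw [if_pos ha, if_neg hb, if_neg hb, sub_zero]
      · rw [if_neg hb, if_pos ha, if_pos ha, zero_sub]
    rw [h1, h2]
    by_cases he : Even (Finset.univ.filter fun i => G.Adj (v (finRotate k i)) (v i)).card
    · rw [he.neg_one_pow, if_pos ⟨h, he⟩]; norm_num
    · rw [(Nat.not_even_iff_odd.1 he).neg_one_pow, if_neg fun h' => he h'.2]; norm_num
  · obtain ⟨i, hi⟩ := not_forall.1 h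
    have hi' : ¬ G.underlying.Adj (v i) (v (finRotate k i)) := by
      rw [underlying_adj hG]
      rintro (h' | h')
      · exact hi (Or.inl ⟨h', hG _ _ h'⟩)
      · exact hi (Or.inr ⟨h', hG _ _ h'⟩)
    have hu : G.und (v i) (v (finRotate k i)) = 0 := by rw [und_eq_ite, if_neg hi']
    have hs : G.sgn (v i) (v (finRotate k i)) = 0 := by
      rw [underlying_adj hG, not_or] at hi'
      rw [sgn_apply_eq hG, out_apply, out_apply, if_neg hi'.1, if_neg hi'.2, sub_zero]
    rw [if_neg fun h' => h h'.1, Finset.prod_eq_zero (Finset.mem_univ i) hu,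
      Finset.prod_eq_zero (Finset.mem_univ i) hs]
    norm_num

end

section

variable {V : Type*} [Fintype V] {G : Digraph V}

/-- The number of homomorphisms of an oriented graph is governed by that of the underlying
graph up to `τ`. -/
theorem sq_card_mul_abs_card_hom_sub_le (hG : G.IsOriented) {b : ℕ} {B : Digraph (Fin b)}
    (hB : B.IsOriented) :
    (Fintype.card V : ℝ) ^ 2 *
      |(Nat.card {f : Fin b → V // ∀ x y, B.Adj x y → G.Adj (f x) (f y)} : ℝ)
        - (1 / 2) ^ B.numEdges * Nat.card {f : Fin b → V //
            ∀ x y, B.underlying.Adj x y → G.underlying.Adj (f x) (f y)}|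
      ≤ B.numEdges * (4 * G.tau * (Fintype.card V : ℝ) ^ b) := by
  classical
  let E : Finset (Fin b × Fin b) := Finset.univ.filter fun p => B.Adj p.1 p.2
  have hE : ∀ p, p ∈ E ↔ B.Adj p.1 p.2 := fun p => by simp [E]
  have hcard : E.card = B.numEdges := by
    rw [numEdges, Nat.card_eq_fintype_card, Fintype.card_subtype]
  have h := sq_card_mul_abs_sum_prod_out_sub_le hG (E := E) (s := Prod.fst) (t := Prod.snd)
    (fun q hq he => by
      have h := (hE q).1 hq
      rw [he] at h
      exact hB _ _ h h)
    -- Two distinct edges of B cannot have the same pair of ends, as B has no antiparallel edges.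
    (fun q hq r hr hne => by
      have h1 := (hE q).1 hq
      have h2 := (hE r).1 hr
      obtain ⟨q1, q2⟩ := q
      obtain ⟨r1, r2⟩ := r
      simp only at h1 h2 ⊢
      rintro ⟨rfl | rfl, rfl | rfl⟩
      · exact hB _ _ h1 h1
      · exact hne rfl
      · exact hB _ _ h1 h2
      · exact hB _ _ h1 h1)
  rw [hcard, Fintype.card_fin] at h
  convert h using 5
  · rw [Nat.card_eq_fintype_card, Fintype.card_subtype, Finset.card_filter]
    push_cast
    refine Finset.sum_congr rfl fun f _ => ?_
    simp_rw [out_apply]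
    rw [prod_ite_one_zero]
    refine if_congr ⟨fun h p hp => h _ _ ((hE p).1 hp), fun h x y hxy => h (x, y) ((hE _).2 hxy)⟩
      rfl rfl
  · rw [Nat.card_eq_fintype_card, Fintype.card_subtype, Finset.card_filter]
    push_cast
    refine Finset.sum_congr rfl fun f _ => ?_
    simp_rw [und_eq_ite]
    rw [prod_ite_one_zero]
    refine if_congr ⟨fun h p hp => h _ _ ((underlying_adj hB _ _).2 (Or.inl ((hE p).1 hp))),
      fun h x y hxy => ?_⟩ rfl rfl
    rcases (underlying_adj hB _ _).1 hxy with h' | h'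
    · exact h (x, y) ((hE _).2 h')
    · exact (h (y, x) ((hE _).2 h')).symm

end

end Digraph

/-! ### The largest eigenvalue, the operator norm and even traces. -/

section Spectral

variable {V : Type*} [Fintype V] [DecidableEq V]

theorem absLambdaOne_nonneg (X : Matrix V V ℝ) : 0 ≤ absLambdaOne X := ENNReal.toReal_nonneg

open scoped Matrix.Norms.L2Operator in
-- Symmetric and skew-symmetric real matrices are normal, and for normal matrices the spectral
-- radius is the operator norm.
theorem absLambdaOne_eq_norm {X : Matrix V V ℝ} (hX : X.transpose = X ∨ X.transpose = -X) :
    absLambdaOne X = ‖X.map Complex.ofReal‖ := by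
  have hstar : star (X.map Complex.ofReal) = X.map Complex.ofReal ∨
      star (X.map Complex.ofReal) = -X.map Complex.ofReal := by
    refine hX.imp (fun h => ?_) fun h => ?_
    · ext u v
      have := congrFun (congrFun h u) v
      simp only [Matrix.transpose_apply] at this
      simp [Matrix.star_apply, this]
    · ext u v
      have := congrFun (congrFun h u) v
      simp only [Matrix.transpose_apply, Matrix.neg_apply] at this
      simp [Matrix.star_apply, this]
  have : IsStarNormal (X.map Complex.ofReal) := ⟨by
    rcases hstar with h | h <;> rw [h]
    exact (Commute.refl _).neg_left⟩
  rw [absLambdaOne, IsStarNormal.spectralRadius_eq_nnnorm]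
  simp

open scoped Matrix.Norms.L2Operator in
theorem abs_sum_mul_le_absLambdaOne {X : Matrix V V ℝ}
    (hX : X.transpose = X ∨ X.transpose = -X) {f g : V → ℝ} (hf : ∀ u, |f u| ≤ 1)
    (hg : ∀ u, |g u| ≤ 1) :
    |∑ u, ∑ v, f u * X u v * g v| ≤ absLambdaOne X * Fintype.card V := by
  have hnorm : ∀ h : V → ℝ, (∀ u, |h u| ≤ 1) →
      ‖(WithLp.toLp 2 fun u => (h u : ℂ) : EuclideanSpace ℂ V)‖ ≤ √(Fintype.card V) := by
    intro h hh
    rw [EuclideanSpace.norm_eq]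
    refine Real.sqrt_le_sqrt ?_
    calc _ ≤ ∑ _u : V, (1 : ℝ) := Finset.sum_le_sum fun u _ => by
          simpa using hh u
      _ = _ := by simp
  have h1 := Matrix.l2_opNorm_mulVec (X.map Complex.ofReal)
    (WithLp.toLp 2 fun u => (g u : ℂ) : EuclideanSpace ℂ V)
  have h2 := norm_inner_le_norm (𝕜 := ℂ) (WithLp.toLp 2 fun u => (f u : ℂ) : EuclideanSpace ℂ V)
    (WithLp.toLp 2 ((X.map Complex.ofReal).mulVec fun u => (g u : ℂ)))
  have h3 : inner ℂ (WithLp.toLp 2 fun u => (f u : ℂ) : EuclideanSpace ℂ V)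
      (WithLp.toLp 2 ((X.map Complex.ofReal).mulVec fun u => (g u : ℂ)))
      = ((∑ u, ∑ v, f u * X u v * g v : ℝ) : ℂ) := by
    rw [PiLp.inner_apply]
    push_cast
    refine Finset.sum_congr rfl fun u _ => ?_
    simp [Matrix.mulVec, dotProduct, mul_comm, mul_left_comm, Finset.mul_sum]
  rw [h3, Complex.norm_real, Real.norm_eq_abs] at h2
  rw [absLambdaOne_eq_norm hX]
  have h4 := hnorm f hf
  have h5 := hnorm g hg
  calc _ ≤ _ := h2
    _ ≤ √(Fintype.card V) * (‖X.map Complex.ofReal‖ * √(Fintype.card V)) := by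
        refine mul_le_mul h4 (h1.trans ?_) (norm_nonneg _) (Real.sqrt_nonneg _)
        gcongr
    _ = ‖X.map Complex.ofReal‖ * (√(Fintype.card V) * √(Fintype.card V)) := by ring
    _ = _ := by rw [Real.mul_self_sqrt (Nat.cast_nonneg _)]

/-- Cauchy–Schwarz in each row of Y v = μ v bounds |μ| by the Frobenius norm. -/
theorem sq_norm_le_sum_sq_of_mem_spectrum {Y : Matrix V V ℝ} {μ : ℂ}
    (hμ : μ ∈ spectrum ℂ (Y.map Complex.ofReal)) : ‖μ‖ ^ 2 ≤ ∑ u, ∑ v, Y u v ^ 2 := by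
  have h := hμ
  rw [← Matrix.spectrum_toLin', ← Module.End.hasEigenvalue_iff_mem_spectrum] at h
  obtain ⟨v, hv⟩ := h.exists_hasEigenvector
  have hne := hv.2
  have heq : (Y.map Complex.ofReal).mulVec v = μ • v := by
    simpa using hv.apply_eq_smul
  have hpos : 0 < ∑ w, ‖v w‖ ^ 2 := by
    obtain ⟨w, hw⟩ := Function.ne_iff.1 hne
    refine Finset.sum_pos' (fun _ _ => by positivity) ⟨w, Finset.mem_univ _, ?_⟩
    have : 0 < ‖v w‖ := norm_pos_iff.2 hw
    positivity
  refine le_of_mul_le_mul_right ?_ hpos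
  rw [Finset.mul_sum, Finset.sum_mul]
  refine Finset.sum_le_sum fun u _ => ?_
  have hu := congrFun heq u
  rw [Pi.smul_apply, smul_eq_mul] at hu
  rw [← mul_pow, ← norm_mul, ← hu]
  calc ‖(Y.map Complex.ofReal).mulVec v u‖ ^ 2 ≤ (∑ w, |Y u w| * ‖v w‖) ^ 2 := by
        gcongr
        rw [Matrix.mulVec, dotProduct]
        refine (norm_sum_le _ _).trans (le_of_eq (Finset.sum_congr rfl fun w _ => ?_))
        rw [norm_mul, Matrix.map_apply, Complex.norm_real, Real.norm_eq_abs]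
    _ ≤ (∑ w, |Y u w| ^ 2) * ∑ w, ‖v w‖ ^ 2 := Finset.sum_mul_sq_le_sq_mul_sq _ _ _
    _ = _ := by simp_rw [sq_abs]

/-- The transpose of X^l is ± X^l, so the squared Frobenius norm Tr(X^l (X^l)ᵀ) is ± Tr X^(2l). -/
theorem sum_sq_pow_eq_abs_trace {X : Matrix V V ℝ} (hX : X.transpose = X ∨ X.transpose = -X)
    (l : ℕ) : ∑ u, ∑ v, (X ^ l) u v ^ 2 = |(X ^ (2 * l)).trace| := by
  have h1 : ∑ u, ∑ v, (X ^ l) u v ^ 2 = ((X ^ l) * (X ^ l).transpose).trace := by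
    rw [Matrix.trace]
    refine Finset.sum_congr rfl fun u _ => ?_
    rw [Matrix.diag_apply, Matrix.mul_apply]
    exact Finset.sum_congr rfl fun v _ => by rw [Matrix.transpose_apply, sq]
  have h2 : (X ^ l).transpose = X ^ l ∨ (X ^ l).transpose = -X ^ l := by
    rw [Matrix.transpose_pow]
    rcases hX with h | h
    · exact Or.inl (by rw [h])
    · rw [h, neg_pow]
      rcases neg_one_pow_eq_or (Matrix V V ℝ) l with h' | h' <;> simp [h']
  have h0 : 0 ≤ ∑ u, ∑ v, (X ^ l) u v ^ 2 := by positivity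
  rw [← abs_of_nonneg h0, h1]
  rcases h2 with h | h <;> rw [h, two_mul, pow_add]
  rw [mul_neg, Matrix.trace_neg, abs_neg]

/-- If μ is an eigenvalue of largest modulus, μ^l is an eigenvalue of X^l, so the Frobenius bound
applies without diagonalising X. -/
theorem absLambdaOne_pow_le [Nonempty V] {X : Matrix V V ℝ}
    (hX : X.transpose = X ∨ X.transpose = -X) (l : ℕ) :
    absLambdaOne X ^ (2 * l) ≤ |(X ^ (2 * l)).trace| := by
  obtain ⟨μ, hμ, hρ⟩ : ∃ μ ∈ spectrum ℂ (X.map Complex.ofReal), ‖μ‖ = absLambdaOne X := by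
    open scoped Matrix.Norms.L2Operator in
    obtain ⟨μ, hμ, h⟩ := spectrum.exists_nnnorm_eq_spectralRadius (X.map Complex.ofReal)
    refine ⟨μ, hμ, ?_⟩
    rw [absLambdaOne, ← h]
    simp
  have h1 : μ ^ l ∈ spectrum ℂ ((X ^ l).map Complex.ofReal) := by
    have := spectrum.pow_mem_pow (X.map Complex.ofReal) l hμ
    rwa [show (X ^ l).map Complex.ofReal = X.map Complex.ofReal ^ l from
      map_pow (Complex.ofRealHom.mapMatrix) X l]
  have h2 := sq_norm_le_sum_sq_of_mem_spectrum h1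
  rwa [norm_pow, hρ, ← pow_mul, mul_comm l 2, sum_sq_pow_eq_abs_trace hX] at h2

end Spectral

namespace Digraph

section

variable {V : Type*} [Fintype V] [DecidableEq V] {G : Digraph V}

theorem tau_le_absLambdaOne (hG : G.IsOriented) :
    G.tau ≤ absLambdaOne G.adjMatrix * Fintype.card V := by
  classical
  refine tau_le fun A B => ?_
  rw [edgesBetween_sub_eq_sum hG]
  have hind : ∀ (S : Finset V) u, |if u ∈ S then (1 : ℝ) else 0| ≤ 1 := fun S u => by
    split_ifs <;> simp
  refine le_trans (le_of_eq ?_) ((le_abs_self _).trans (abs_sum_mul_le_absLambdaOne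
    (Or.inr (adjMatrix_transpose hG)) (hind A) (hind B)))
  simp [sgn]

theorem two_mul_numEdges_le_absLambdaOne (hG : G.IsOriented) :
    2 * (G.numEdges : ℝ) ≤ absLambdaOne G.underlyingAdjMatrix * Fintype.card V := by
  rw [two_mul_numEdges_eq_sum hG]
  refine le_trans (le_of_eq ?_) ((le_abs_self _).trans (abs_sum_mul_le_absLambdaOne
    (f := fun _ => 1) (g := fun _ => 1) (Or.inl (underlyingAdjMatrix_transpose hG))
    (by simp) (by simp)))
  simp [und]

theorem absLambdaOne_underlyingAdjMatrix_le [Nonempty V] (hG : G.IsOriented) :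
    absLambdaOne G.underlyingAdjMatrix ≤ Fintype.card V := by
  have hX : G.underlyingAdjMatrix.transpose = G.underlyingAdjMatrix ∨
      G.underlyingAdjMatrix.transpose = -G.underlyingAdjMatrix :=
    Or.inl (underlyingAdjMatrix_transpose hG)
  have h := absLambdaOne_pow_le hX 1
  rw [← sum_sq_pow_eq_abs_trace hX, pow_one] at h
  refine (pow_le_pow_iff_left₀ (absLambdaOne_nonneg _) (Nat.cast_nonneg _) two_ne_zero).1 ?_
  refine h.trans ?_
  calc _ ≤ ∑ _u : V, ∑ _v : V, (1 : ℝ) := Finset.sum_le_sum fun u _ => Finset.sum_le_sum fun v _ =>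
        pow_le_one₀ (und_nonneg u v) (und_le_one u v)
    _ = _ := by simp [sq]

end

end Digraph

/-! ### A trace inequality for the alternating product. -/

section FourCycleTrace

variable {V : Type*} [Fintype V]

theorem Matrix.trace_transpose_mul_self_nonneg (X : Matrix V V ℝ) :
    0 ≤ (X.transpose * X).trace := by
  rw [Matrix.trace]
  refine Finset.sum_nonneg fun u _ => ?_
  rw [Matrix.diag_apply, Matrix.mul_apply]
  exact Finset.sum_nonneg fun v _ => mul_self_nonneg _

/-- The difference of the two sides is ‖AM - MA‖² + 2‖AM‖² in Frobenius norm; mixed terms of odd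
degree in A cancel by cyclicity of the trace. -/
theorem Matrix.trace_add_trace_le [DecidableEq V] {M A : Matrix V V ℝ} (hM : M.transpose = M)
    (hA : A.transpose = -A) :
    (M ^ 4).trace + (A ^ 4).trace ≤ ((M + A) * ((M - A) * ((M + A) * (M - A)))).trace := by
  have h1 := Matrix.trace_transpose_mul_self_nonneg (A * M - M * A)
  have h2 := Matrix.trace_transpose_mul_self_nonneg (A * M)
  rw [Matrix.transpose_sub, Matrix.transpose_mul, Matrix.transpose_mul, hM, hA] at h1
  rw [Matrix.transpose_mul, hM, hA] at h2
  have e : (M + A) * ((M - A) * ((M + A) * (M - A))) = M ^ 4 + A ^ 4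
      + (M * -A - -A * M) * (A * M - M * A)
      + (M * (M * A * M) - M * A * M * M) + (A * M * M * M - M * M * (M * A))
      + (A * (A * M * A) - A * A * A * M) + (M * A * A * A - A * M * A * A)
      - (M * M * A * A) - (A * A * M * M) := by
    noncomm_ring
  rw [e]
  simp only [Matrix.trace_add, Matrix.trace_sub]
  have c1 : (M * (M * A * M)).trace = (M * A * M * M).trace := Matrix.trace_mul_comm _ _
  have c2 : (M * M * (M * A)).trace = (A * M * M * M).trace := by
    rw [← Matrix.mul_assoc, Matrix.trace_mul_comm]
    simp only [Matrix.mul_assoc]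
  have c3 : (A * (A * M * A)).trace = (A * A * A * M).trace := by
    rw [← Matrix.mul_assoc, Matrix.trace_mul_comm]
    simp only [Matrix.mul_assoc]
  have c4 : (M * A * A * A).trace = (A * M * A * A).trace := by
    rw [Matrix.trace_mul_comm]
    simp only [Matrix.mul_assoc]
  have c5 : (M * -A * (A * M)).trace = - (M * M * A * A).trace := by
    rw [← Matrix.mul_assoc, Matrix.trace_mul_comm]
    simp only [Matrix.mul_assoc, neg_mul, mul_neg, Matrix.trace_neg]
  have c6 : (A * A * M * M).trace = (M * M * A * A).trace := by
    rw [Matrix.mul_assoc, Matrix.trace_mul_comm]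
    simp only [Matrix.mul_assoc]
  rw [c5] at h2
  linarith

end FourCycleTrace

namespace Digraph

/-! ### Labelled against unlabelled copies. -/

section Unlabelled

/-- Automorphisms of a digraph. -/
abbrev Automorphism {W : Type*} (B : Digraph W) : Type _ :=
  {σ : Equiv.Perm W // ∀ a b, B.Adj (σ a) (σ b) ↔ B.Adj a b}

variable {V W : Type*} (B : Digraph W) (G : Digraph V)

/-- The copy of `B` that is the image of an embedding. -/
def imageCopy (f : W → V) : Set V × Set (V × V) :=
  (Set.range f, {p | ∃ a b, B.Adj a b ∧ p = (f a, f b)})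

variable {B}

theorem imageCopy_comp_automorphism (f : W → V) (σ : B.Automorphism) :
    B.imageCopy (f ∘ σ.1) = B.imageCopy f := by
  refine Prod.ext (σ.1.surjective.range_comp f) (Set.ext fun p => ⟨?_, ?_⟩)
  · rintro ⟨a, b, hab, rfl⟩
    exact ⟨σ.1 a, σ.1 b, (σ.2 a b).2 hab, rfl⟩
  · rintro ⟨a, b, hab, rfl⟩
    exact ⟨σ.1.symm a, σ.1.symm b, by rw [← σ.2]; simpa using hab, by simp⟩

theorem exists_automorphism_of_imageCopy_eq {f g : W ↪ V} (h : B.imageCopy f = B.imageCopy g) :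
    ∃ σ : B.Automorphism, ∀ a, g a = f (σ.1 a) := by
  have hr : Set.range f = Set.range g := congrArg Prod.fst h
  have he : ∀ p, (∃ a b, B.Adj a b ∧ p = (f a, f b)) ↔ ∃ a b, B.Adj a b ∧ p = (g a, g b) :=
    fun p => Set.ext_iff.1 (congrArg Prod.snd h) p
  let σ : Equiv.Perm W := (Equiv.ofInjective g g.injective).trans
    ((Equiv.setCongr hr.symm).trans (Equiv.ofInjective f f.injective).symm)
  have hσ : ∀ a, g a = f (σ a) := fun a => by
    have : (Equiv.ofInjective f f.injective (σ a) : V) = g a := by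
      simp only [σ, Equiv.trans_apply, Equiv.apply_symm_apply]
      rfl
    exact this.symm
  refine ⟨⟨σ, fun a b => ⟨fun hab => ?_, fun hab => ?_⟩⟩, hσ⟩
  · obtain ⟨a', b', h', e⟩ := (he (f (σ a), f (σ b))).1 ⟨_, _, hab, rfl⟩
    rw [← hσ, ← hσ, Prod.mk.injEq] at e
    rwa [g.injective e.1, g.injective e.2]
  · obtain ⟨a', b', h', e⟩ := (he (g a, g b)).2 ⟨_, _, hab, rfl⟩
    rw [hσ, hσ, Prod.mk.injEq] at e
    rwa [f.injective e.1, f.injective e.2]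

/-- Every unlabelled copy is counted once for each automorphism among the labelled copies. -/
theorem labelledCount_eq_mul_unlabelledCount :
    B.labelledCount G = B.unlabelledCount G * Nat.card B.Automorphism := by
  rw [labelledCount, unlabelledCount, ← Nat.card_coe_set_eq, ← Nat.card_prod]
  set S : Set (Set V × Set (V × V)) := {H | ∃ f : W ↪ V, (∀ a b, B.Adj a b → G.Adj (f a) (f b)) ∧
    H.1 = Set.range f ∧ H.2 = {p | ∃ a b, B.Adj a b ∧ p = (f a, f b)}} with hS
  -- Fix one embedding per copy; every embedding with that image is the chosen one composed with a
  -- unique automorphism.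
  choose s hs1 hs2 using fun y : S => y.2
  have hs3 : ∀ y : S, B.imageCopy (s y) = y := fun y => Prod.ext (hs2 y).1.symm (hs2 y).2.symm
  refine (Nat.card_congr (Equiv.ofBijective (fun p : S × B.Automorphism =>
    (⟨p.2.1.toEmbedding.trans (s p.1), fun a b hab => hs1 _ _ _ ((p.2.2 a b).2 hab)⟩ :
      {f : W ↪ V // ∀ a b, B.Adj a b → G.Adj (f a) (f b)})) ⟨?_, ?_⟩)).symm
  · rintro ⟨y, σ⟩ ⟨z, ρ⟩ h
    have h' : ∀ a, s y (σ.1 a) = s z (ρ.1 a) := fun a => DFunLike.congr_fun (congrArg Subtype.val h) a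
    have hyz : y = z := by
      have h1 := imageCopy_comp_automorphism (s y) σ
      have h2 := imageCopy_comp_automorphism (s z) ρ
      rw [hs3] at h1 h2
      rw [show ⇑(s y) ∘ σ.1 = ⇑(s z) ∘ ρ.1 from funext h', h2] at h1
      exact Subtype.ext h1.symm
    subst hyz
    exact Prod.ext rfl (Subtype.ext (Equiv.ext fun a => (s y).injective (h' a)))
  · rintro ⟨g, hg⟩
    obtain ⟨σ, hσ⟩ := exists_automorphism_of_imageCopy_eq
      (hs3 ⟨B.imageCopy g, g, hg, rfl, rfl⟩)
    exact ⟨(_, σ), Subtype.ext (DFunLike.ext _ _ fun a => (hσ a).symm)⟩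

theorem labelledCount_fourCycle :
    fourCycle.labelledCount G = 4 * fourCycle.unlabelledCount G := by
  have : Nat.card fourCycle.Automorphism = 4 := by
    let _ : DecidableRel fourCycle.Adj := fun a b => by unfold fourCycle; infer_instance
    rw [Nat.card_eq_fintype_card]
    decide +kernel
  rw [labelledCount_eq_mul_unlabelledCount, this, mul_comm]

/-- Reading graphs as symmetric (hence not oriented) digraphs lets the automorphism count apply to
the undirected 4-cycle as well. -/
theorem copyCount_eq_unlabelledCount {V W : Type*} [Fintype V] [Fintype W] (K : SimpleGraph V)
    (H : SimpleGraph W) :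
    K.copyCount H = (Digraph.mk H.Adj).unlabelledCount (Digraph.mk K.Adj) := by
  classical
  rw [SimpleGraph.copyCount_eq_card_image_copyToSubgraph, unlabelledCount,
    ← Set.ncard_coe_finset]
  have hinj : Function.Injective fun S : K.Subgraph =>
      (S.verts, {p : V × V | S.Adj p.1 p.2}) := by
    intro S T h
    rw [Prod.mk.injEq] at h
    refine SimpleGraph.Subgraph.ext h.1 ?_
    funext x y
    exact propext (Set.ext_iff.1 h.2 (x, y))
  rw [← Set.ncard_image_of_injective _ hinj]
  congr 1
  ext ⟨P, Q⟩
  simp only [Finset.coe_image, Finset.coe_univ, Set.image_univ, Set.mem_image, Set.mem_range,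
    exists_exists_eq_and, Prod.mk.injEq, Set.mem_ofPred_eq]
  constructor
  · rintro ⟨f, h1, h2⟩
    refine ⟨⟨f.toHom, f.injective⟩, fun a b h => f.toHom.map_rel h, ?_, ?_⟩
    · rw [← h1]
      simp
    · rw [← h2]
      ext ⟨x, y⟩
      simp [Relation.Map]
      exact ⟨fun ⟨a, b, h, e1, e2⟩ => ⟨a, b, h, e1.symm, e2.symm⟩,
        fun ⟨a, b, h, e1, e2⟩ => ⟨a, b, h, e1.symm, e2.symm⟩⟩
  · rintro ⟨f, hf, rfl, rfl⟩
    refine ⟨⟨⟨f, fun {a b} h => hf a b h⟩, f.injective⟩, ?_, ?_⟩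
    · simp
    · ext ⟨x, y⟩
      simp [Relation.Map]
      exact ⟨fun ⟨a, b, h, e1, e2⟩ => ⟨a, b, h, e1.symm, e2.symm⟩,
        fun ⟨a, b, h, e1, e2⟩ => ⟨a, b, h, e1.symm, e2.symm⟩⟩

theorem labelledCopyCount_cycleGraph_four {V : Type*} [Fintype V] (K : SimpleGraph V) :
    K.labelledCopyCount (SimpleGraph.cycleGraph 4)
      = 8 * K.copyCount (SimpleGraph.cycleGraph 4) := by
  have : Nat.card (Digraph.mk (SimpleGraph.cycleGraph 4).Adj).Automorphism = 8 := by
    let _ : DecidableRel (Digraph.mk (SimpleGraph.cycleGraph 4).Adj).Adj := fun a b =>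
      inferInstanceAs (Decidable ((SimpleGraph.cycleGraph 4).Adj a b))
    rw [Nat.card_eq_fintype_card]
    decide +kernel
  rw [labelledCopyCount_eq_card, copyCount_eq_unlabelledCount, mul_comm, ← this]
  exact labelledCount_eq_mul_unlabelledCount (B := Digraph.mk (SimpleGraph.cycleGraph 4).Adj)
    (Digraph.mk K.Adj)

end Unlabelled

section

variable {V : Type*} [Fintype V] [DecidableEq V] {G : Digraph V}

/-- A(Ḡ) + A(G) is twice the directed adjacency matrix and A(Ḡ) - A(G) twice its transpose. Their
alternating product of length four traces the orientation 0 → 1 ← 2 → 3 ← 0, with the factor 2⁴ =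
16. -/
theorem trace_add_trace_le_card_hom_fourCycle (hG : G.IsOriented) :
    (G.underlyingAdjMatrix ^ 4).trace + (G.adjMatrix ^ 4).trace
      ≤ 16 * Nat.card {f : Fin 4 → V // ∀ a b, fourCycle.Adj a b → G.Adj (f a) (f b)} := by
  classical
  refine (Matrix.trace_add_trace_le (underlyingAdjMatrix_transpose hG)
    (adjMatrix_transpose hG)).trans (le_of_eq ?_)
  have hp : G.underlyingAdjMatrix + G.adjMatrix = (2 : ℝ) • Matrix.of G.out := by
    ext u v
    change G.und u v + G.sgn u v = 2 * G.out u v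
    rw [und_apply_eq hG, sgn_apply_eq hG]
    ring
  have hm : G.underlyingAdjMatrix - G.adjMatrix = (2 : ℝ) • (Matrix.of G.out).transpose := by
    ext u v
    change G.und u v - G.sgn u v = 2 * G.out v u
    rw [und_apply_eq hG, sgn_apply_eq hG]
    ring
  have hcard : (Nat.card {f : Fin 4 → V // ∀ a b, fourCycle.Adj a b → G.Adj (f a) (f b)} : ℝ)
      = ∑ f : Fin 4 → V, G.out (f 0) (f 1) * (G.out (f 2) (f 1) * (G.out (f 2) (f 3)
        * G.out (f 0) (f 3))) := by
    rw [Nat.card_eq_fintype_card, Fintype.card_subtype, Finset.card_filter]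
    push_cast
    refine Finset.sum_congr rfl fun f _ => ?_
    simp only [out_apply, mul_ite, mul_one, mul_zero, ← ite_and]
    refine if_congr ?_ rfl rfl
    have h3 : Odd 3 := by decide
    have h3' : ¬ Even 3 := by decide
    simp only [Fin.forall_fin_succ, fourCycle]
    simp [h3, h3']
    tauto
  rw [hp, hm, hcard]
  simp only [Matrix.smul_mul, Matrix.mul_smul, smul_smul, Matrix.trace_smul, smul_eq_mul]
  congr 1
  · norm_num
  have hsum : ∀ {k : ℕ} (F : (Fin (k + 1) → V) → ℝ),
      ∑ f, F f = ∑ u, ∑ f, F (Fin.cons u f) := by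
    intro k F
    rw [← Equiv.sum_comp (Fin.consEquiv fun _ : Fin (k + 1) => V), Fintype.sum_prod_type]
    rfl
  rw [hsum, Matrix.trace]
  refine Finset.sum_congr rfl fun a _ => ?_
  rw [hsum, Matrix.diag_apply, Matrix.mul_apply]
  refine Finset.sum_congr rfl fun b _ => ?_
  rw [hsum, Matrix.mul_apply, Finset.mul_sum]
  refine Finset.sum_congr rfl fun c _ => ?_
  rw [hsum, Matrix.mul_apply, Finset.mul_sum, Finset.mul_sum]
  refine Finset.sum_congr rfl fun d _ => ?_
  rw [Fintype.sum_unique]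
  rfl

end

end Digraph

theorem Asymptotics.IsLittleO.of_abs_le {α : Type*} {l : Filter α} {f g h : α → ℝ}
    (hg : g =o[l] h) (hfg : ∀ᶠ i in l, |f i| ≤ g i) : f =o[l] h :=
  (IsBigO.of_bound' (hfg.mono fun i hi => hi.trans (le_abs_self (g i)))).trans_isLittleO hg

namespace Digraph

/-! ### Asymptotic forms of the estimates. -/

section Asymptotics

variable {V : ℕ → Type*} [∀ i, Fintype (V i)]

/-- The number of vertices along a sequence, as a real number. -/
noncomputable abbrev order (V : ℕ → Type*) [∀ i, Fintype (V i)] (i : ℕ) : ℝ := Fintype.card (V i)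

theorem tendsto_order (hn : Tendsto (fun i => Fintype.card (V i)) atTop atTop) :
    Tendsto (order V) atTop atTop := tendsto_natCast_atTop_atTop.comp hn

theorem order_pow_sub_descFactorial_isLittleO
    (hn : Tendsto (fun i => Fintype.card (V i)) atTop atTop) (b : ℕ) :
    (fun i => order V i ^ b - ((Fintype.card (V i)).descFactorial b : ℝ))
      =o[atTop] (fun i => order V i ^ b) := by
  have h := ((isEquivalent_descFactorial b).isLittleO).comp_tendsto hn
  refine h.neg_left.congr_left fun i => ?_
  simp [order]

theorem card_fun_sub_card_embedding_isLittleO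
    (hn : Tendsto (fun i => Fintype.card (V i)) atTop atTop) {b : ℕ}
    (Q : ∀ i, (Fin b → V i) → Prop) :
    (fun i => (Nat.card {f : Fin b → V i // Q i f} : ℝ) - Nat.card {f : Fin b ↪ V i // Q i f})
      =o[atTop] (fun i => order V i ^ b) := by
  refine (order_pow_sub_descFactorial_isLittleO hn b).of_abs_le (Eventually.of_forall fun i => ?_)
  obtain ⟨h1, h2⟩ := card_embedding_le_card_fun (Q i)
  rw [Fintype.card_fin] at h2
  have h3 := Nat.descFactorial_le_pow (Fintype.card (V i)) b
  have h1' : (Nat.card {f : Fin b ↪ V i // Q i f} : ℝ) ≤ Nat.card {f : Fin b → V i // Q i f} := by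
    exact_mod_cast h1
  have h2' : (Nat.card {f : Fin b → V i // Q i f} : ℝ) ≤ Nat.card {f : Fin b ↪ V i // Q i f}
      + (order V i ^ b - ((Fintype.card (V i)).descFactorial b : ℝ)) := by
    have := (Nat.cast_le (α := ℝ)).2 h2
    rwa [Nat.cast_add, Nat.cast_sub h3, Nat.cast_pow] at this
  rw [abs_of_nonneg (by linarith)]
  linarith

theorem eventually_nonempty (hn : Tendsto (fun i => Fintype.card (V i)) atTop atTop) :
    ∀ᶠ i in atTop, Nonempty (V i) :=
  (hn.eventually_ge_atTop 1).mono fun _ hi => Fintype.card_pos_iff.1 hi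

variable {G : ∀ i, Digraph (V i)}

theorem numEdges_isTheta
    (hm : ∃ c : ℝ, 0 < c ∧ ∀ᶠ i in atTop, c * (Fintype.card (V i) : ℝ) ^ 2 ≤ (G i).numEdges) :
    (fun i => ((G i).numEdges : ℝ)) =Θ[atTop] (fun i => order V i ^ 2) := by
  obtain ⟨c, hc, hm⟩ := hm
  refine ⟨IsBigO.of_bound' (Eventually.of_forall fun i => ?_), IsBigO.of_bound c⁻¹ ?_⟩
  · rw [Real.norm_of_nonneg (Nat.cast_nonneg _), Real.norm_of_nonneg (by positivity)]
    exact numEdges_le (G i)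
  · filter_upwards [hm] with i hi
    rw [Real.norm_of_nonneg (Nat.cast_nonneg _), Real.norm_of_nonneg (by positivity),
      le_inv_mul_iff₀ hc]
    exact hi

/-- Homomorphism counts of bipartite graphs have full order of magnitude. -/
theorem card_hom_isTheta (hG : ∀ i, (G i).IsOriented)
    (hm : ∃ c : ℝ, 0 < c ∧ ∀ᶠ i in atTop, c * (Fintype.card (V i) : ℝ) ^ 2 ≤ (G i).numEdges)
    {b : ℕ} {H : SimpleGraph (Fin b)} (hH : H.Colorable 2) :
    (fun i => (Nat.card {f : Fin b → V i //
        ∀ x y, H.Adj x y → (G i).underlying.Adj (f x) (f y)} : ℝ))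
      =Θ[atTop] (fun i => order V i ^ b) := by
  classical
  obtain ⟨c, hc, hm⟩ := hm
  refine ⟨IsBigO.of_bound' (Eventually.of_forall fun i => ?_),
    IsBigO.of_bound ((min 1 (2 * c)) ^ (b ^ 2))⁻¹ ?_⟩
  · rw [Real.norm_of_nonneg (Nat.cast_nonneg _), Real.norm_of_nonneg (by positivity)]
    have : Nat.card {f : Fin b → V i // ∀ x y, H.Adj x y → (G i).underlying.Adj (f x) (f y)}
        ≤ Fintype.card (V i) ^ b := by
      rw [Nat.card_eq_fintype_card]
      refine (Fintype.card_subtype_le _).trans ?_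
      rw [Fintype.card_fun, Fintype.card_fin]
    exact_mod_cast this
  · filter_upwards [hm] with i hi
    rw [Real.norm_of_nonneg (Nat.cast_nonneg _), Real.norm_of_nonneg (by positivity),
      le_inv_mul_iff₀ (by positivity)]
    have := le_card_hom_of_colorable (hG i) hH hc hi
    rwa [Fintype.card_fin] at this

theorem card_hom_sub_labelledCopyCount_isLittleO
    (hn : Tendsto (fun i => Fintype.card (V i)) atTop atTop) {b : ℕ} (H : SimpleGraph (Fin b)) :
    (fun i => (Nat.card {f : Fin b → V i //
        ∀ x y, H.Adj x y → (G i).underlying.Adj (f x) (f y)} : ℝ)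
          - (G i).underlying.labelledCopyCount H)
      =o[atTop] (fun i => order V i ^ b) := by
  simp_rw [labelledCopyCount_eq_card]
  exact card_fun_sub_card_embedding_isLittleO hn
    fun i f => ∀ x y, H.Adj x y → (G i).underlying.Adj (f x) (f y)

theorem labelledCopyCount_isTheta (hG : ∀ i, (G i).IsOriented)
    (hn : Tendsto (fun i => Fintype.card (V i)) atTop atTop)
    (hm : ∃ c : ℝ, 0 < c ∧ ∀ᶠ i in atTop, c * (Fintype.card (V i) : ℝ) ^ 2 ≤ (G i).numEdges)
    {b : ℕ} {H : SimpleGraph (Fin b)} (hH : H.Colorable 2) :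
    (fun i => ((G i).underlying.labelledCopyCount H : ℝ))
      =Θ[atTop] (fun i => order V i ^ b) := by
  have h1 := card_hom_isTheta hG hm hH
  have h2 := (card_hom_sub_labelledCopyCount_isLittleO (G := G) hn H).neg_left.trans_isTheta h1.symm
  refine IsTheta.trans ⟨?_, ?_⟩ h1
  · refine ((isBigO_refl _ _).add h2.isBigO).congr_left fun i => ?_
    ring
  · refine h2.right_isBigO_add.congr_right fun i => ?_
    ring

theorem colorable_cycleGraph {k : ℕ} (hk : Even k) (hk4 : 4 ≤ k) :
    (SimpleGraph.cycleGraph k).Colorable 2 := by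
  have h := SimpleGraph.chromaticNumber_cycleGraph_of_even k (by omega) hk
  exact SimpleGraph.chromaticNumber_le_iff_colorable.1 h.le

theorem isLittleO_of_sq_order_mul_le
    (hn : Tendsto (fun i => Fintype.card (V i)) atTop atTop) {t x : ℕ → ℝ} {C : ℝ} {b : ℕ}
    (ht : t =o[atTop] fun i => order V i ^ 2)
    (h : ∀ i, order V i ^ 2 * |x i| ≤ C * (t i * order V i ^ b)) :
    x =o[atTop] fun i => order V i ^ b := by
  have h1 : (fun i => order V i ^ 2 * x i) =o[atTop] fun i => order V i ^ 2 * order V i ^ b := by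
    refine ((ht.mul_isBigO (isBigO_refl (fun i => order V i ^ b) atTop)).const_mul_left C).of_abs_le
      (Eventually.of_forall fun i => ?_)
    rw [abs_mul, abs_of_nonneg (by positivity : 0 ≤ order V i ^ 2)]
    exact h i
  have h2 : ∀ᶠ i in atTop, order V i ≠ 0 := (tendsto_order hn).eventually_ne_atTop 0
  have h3 := (isBigO_refl (fun i => (order V i ^ 2)⁻¹) atTop).mul_isLittleO h1
  refine h3.congr' ?_ ?_ <;>
  · filter_upwards [h2] with i hi
    field_simp

theorem surplus_isLittleO (hG : ∀ i, (G i).IsOriented)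
    (hn : Tendsto (fun i => Fintype.card (V i)) atTop atTop)
    (ht : (fun i => (G i).tau) =o[atTop] fun i => order V i ^ 2) :
    (fun i => (G i).surplus) =o[atTop] fun i => order V i ^ 2 := by
  refine IsLittleO.of_bound fun ε hε => ?_
  -- This constant makes the at most 2/ε + 1 interval cuts cost ε n²/2 in total.
  have h1 := ht.bound (show 0 < ε / (2 * (2 / ε + 1)) by positivity)
  filter_upwards [h1, (tendsto_order hn).eventually_ge_atTop (2 / ε)] with i h1 h2
  have hN : 0 < order V i := lt_of_lt_of_le (by positivity) h2
  rw [Real.norm_of_nonneg (tau_nonneg _), Real.norm_of_nonneg (by positivity)] at h1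
  have h0 := (tauStar_nonneg (G i)).trans (tauStar_le_two_mul_surplus (hG i))
  rw [Real.norm_of_nonneg (by linarith), Real.norm_of_nonneg (by positivity)]
  -- Interval length about ε n/2. Since n ≥ 2/ε, rounding up keeps s ≤ ε n, so 2π ≤ ε n²/2 + ε n².
  set s := ⌈ε / 2 * order V i⌉₊ with hs
  have hpos : 0 < ε / 2 * order V i := by positivity
  have hs0 : 0 < s := Nat.ceil_pos.2 hpos
  have hs1 : ε / 2 * order V i ≤ s := Nat.le_ceil _
  have hs2 : (s : ℝ) < ε / 2 * order V i + 1 := Nat.ceil_lt_add_one hpos.le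
  have h3 := two_mul_surplus_le (hG i) hs0
  have h4 : ((Fintype.card (V i) / s : ℕ) : ℝ) ≤ 2 / ε := by
    refine Nat.cast_div_le.trans ?_
    rw [div_le_div_iff₀ (by exact_mod_cast hs0) hε]
    change order V i * ε ≤ _
    linarith
  have h5 : (((Fintype.card (V i) / s : ℕ) : ℝ) + 1) * (G i).tau ≤ ε / 2 * order V i ^ 2 := by
    calc _ ≤ (2 / ε + 1) * (ε / (2 * (2 / ε + 1)) * order V i ^ 2) := by
          refine mul_le_mul (by linarith) h1 (tau_nonneg _) (by positivity)
      _ = _ := by field_simp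
  have h6 : order V i * s ≤ ε * order V i ^ 2 := by
    have : 1 ≤ ε / 2 * order V i := by
      rw [div_le_iff₀ hε] at h2
      linarith
    calc order V i * s ≤ order V i * (ε * order V i) := by gcongr; linarith
      _ = _ := by ring
  have h7 : 0 ≤ ε * order V i ^ 2 := by positivity
  linarith

theorem exists_bias_isLittleO {t M : ℕ → ℝ} (ht0 : ∀ i, 0 ≤ t i) (hM : ∀ i, 0 ≤ M i)
    (ht : t =o[atTop] M) :
    ∃ η : ℕ → ℝ, (∀ i, 0 < η i ∧ η i < 1) ∧ Tendsto η atTop (𝓝 0) ∧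
      (fun i => t i / η i) =o[atTop] M := by
  have hq := ht.tendsto_div_nhds_zero
  have hq0 : ∀ i, 0 ≤ t i / M i := fun i => div_nonneg (ht0 i) (hM i)
  set s : ℕ → ℝ := fun i => √(t i / M i) + 1 / ((i : ℝ) + 1) with hs
  have hspos : ∀ i, 0 < s i := fun i => by
    have := Real.sqrt_nonneg (t i / M i)
    positivity
  have hstend : Tendsto s atTop (𝓝 0) := by
    have h1 : Tendsto (fun i => √(t i / M i)) atTop (𝓝 0) := by
      have := (Real.continuous_sqrt.tendsto 0).comp hq
      rwa [Real.sqrt_zero] at this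
    simpa [hs] using h1.add tendsto_one_div_add_atTop_nhds_zero_nat
  refine ⟨fun i => s i / (1 + s i), fun i => ⟨?_, ?_⟩, ?_, ?_⟩
  · have := hspos i; positivity
  · have := hspos i
    rw [div_lt_one (by linarith)]
    linarith
  · have : Tendsto (fun i => s i / (1 + s i)) atTop (𝓝 (0 / (1 + 0))) :=
      hstend.div (hstend.const_add 1) (by norm_num)
    simpa using this
  · have hz : Tendsto (fun i => s i * (1 + s i)) atTop (𝓝 0) := by
      have := hstend.mul (hstend.const_add 1)
      simpa using this
    refine IsLittleO.of_bound fun c hc => ?_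
    filter_upwards [ht.bound (one_pos), hz.eventually (gt_mem_nhds hc)] with i h1 h2
    have hsi := hspos i
    rw [Real.norm_of_nonneg (by have := ht0 i; positivity), Real.norm_of_nonneg (hM i)]
    have h3 : t i ≤ s i * s i * M i := by
      -- If M i = 0 the quotient t/M is 0 by convention and says nothing; the eventual bound t ≤ M
      -- then gives t = 0.
      rcases (hM i).eq_or_lt with h0 | h0
      · rw [Real.norm_of_nonneg (ht0 i), ← h0] at h1
        rw [← h0]
        simpa using h1
      · have h4 : √(t i / M i) ≤ s i := by
          have : 0 ≤ 1 / ((i : ℝ) + 1) := by positivity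
          simp only [hs]; linarith
        have h5 : t i / M i ≤ s i * s i := by
          rw [← Real.mul_self_sqrt (hq0 i)]
          exact mul_self_le_mul_self (Real.sqrt_nonneg _) h4
        rwa [div_le_iff₀ h0] at h5
    calc t i / (s i / (1 + s i)) ≤ (s i * s i * M i) / (s i / (1 + s i)) := by gcongr
      _ = s i * (1 + s i) * M i := by field_simp
      _ ≤ c * M i := mul_le_mul_of_nonneg_right h2.le (hM i)

theorem bias_isLittleO_iff
    (hm : ∃ c : ℝ, 0 < c ∧ ∀ᶠ i in atTop, c * (Fintype.card (V i) : ℝ) ^ 2 ≤ (G i).numEdges) :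
    (∃ δ : ℕ → ℝ, (∀ i, 0 < δ i ∧ δ i < 1) ∧ Tendsto δ atTop (𝓝 1) ∧
        (fun i => (G i).bias (δ i)) =o[atTop] (fun i => ((G i).numEdges : ℝ))) ↔
      (fun i => (G i).tau) =o[atTop] fun i => order V i ^ 2 := by
  rw [← (numEdges_isTheta hm).isLittleO_congr_right]
  constructor
  · rintro ⟨δ, hδ, hlim, hb⟩
    have h1 : (fun i => (1 - δ i) * ((G i).numEdges : ℝ))
        =o[atTop] (fun i => ((G i).numEdges : ℝ)) := by
      have : (fun i => 1 - δ i) =o[atTop] (fun _ => (1 : ℝ)) :=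
        (isLittleO_one_iff ℝ).2 (by simpa using hlim.const_sub 1)
      simpa using this.mul_isBigO (isBigO_refl (fun i => ((G i).numEdges : ℝ)) atTop)
    refine (hb.add h1).of_abs_le (Eventually.of_forall fun i => ?_)
    rw [abs_of_nonneg (tau_nonneg _)]
    exact tau_le_bias_add (hδ i).2
  · intro ht
    obtain ⟨η, h1, h2, h3⟩ := exists_bias_isLittleO (fun i => tau_nonneg (G i))
      (fun i => Nat.cast_nonneg _) ht
    refine ⟨fun i => 1 - η i, fun i => ⟨by linarith [(h1 i).2], by linarith [(h1 i).1]⟩,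
      by simpa using h2.const_sub 1, h3.of_abs_le (Eventually.of_forall fun i => ?_)⟩
    rw [abs_of_nonneg (bias_nonneg _ _)]
    have := bias_le_tau_div (G := G i) (show 1 - η i < 1 by linarith [(h1 i).1])
    rwa [sub_sub_cancel] at this

/-- Sequences with small discrepancy have quasirandom counts of oriented graphs. -/
theorem labelledCount_sub_isLittleO (hG : ∀ i, (G i).IsOriented)
    (hn : Tendsto (fun i => Fintype.card (V i)) atTop atTop)
    (ht : (fun i => (G i).tau) =o[atTop] fun i => order V i ^ 2) {b : ℕ} {B : Digraph (Fin b)}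
    (hB : B.IsOriented) :
    (fun i => (B.labelledCount (G i) : ℝ)
        - (1 / 2) ^ B.numEdges * ((G i).underlying.labelledCopyCount B.underlying : ℝ))
      =o[atTop] (fun i => order V i ^ b) := by
  have h1 : (fun i => (Nat.card {f : Fin b → V i // ∀ x y, B.Adj x y → (G i).Adj (f x) (f y)} : ℝ)
      - B.labelledCount (G i)) =o[atTop] (fun i => order V i ^ b) :=
    card_fun_sub_card_embedding_isLittleO hn
      fun i f => ∀ x y, B.Adj x y → (G i).Adj (f x) (f y)
  have h2 := (card_hom_sub_labelledCopyCount_isLittleO (G := G) hn B.underlying).const_mul_left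
    ((1 / 2) ^ B.numEdges)
  have h3 := isLittleO_of_sq_order_mul_le hn (C := B.numEdges * 4) ht fun i =>
    (sq_card_mul_abs_card_hom_sub_le (hG i) hB).trans (le_of_eq (by ring))
  refine ((h3.sub h1).add h2).congr_left fun i => ?_
  ring

theorem isOriented_fourCycle : fourCycle.IsOriented := by
  intro u v h h'
  exact Nat.not_even_iff_odd.2 h.2 h'.1

theorem underlying_fourCycle : fourCycle.underlying = SimpleGraph.cycleGraph 4 := by
  ext u v
  rw [underlying_adj isOriented_fourCycle]
  simp only [fourCycle]
  revert u v
  decide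

theorem numEdges_fourCycle : fourCycle.numEdges = 4 := by
  let _ : DecidableRel fourCycle.Adj := fun a b => by unfold fourCycle; infer_instance
  rw [numEdges, Nat.card_eq_fintype_card]
  decide +kernel

variable [∀ i, DecidableEq (V i)]

theorem trace_underlyingAdjMatrix_pow_sub_isLittleO
    (hn : Tendsto (fun i => Fintype.card (V i)) atTop atTop) {k : ℕ} (hk : 2 ≤ k) :
    (fun i => ((G i).underlyingAdjMatrix ^ k).trace
        - (G i).underlying.labelledCopyCount (SimpleGraph.cycleGraph k))
      =o[atTop] (fun i => order V i ^ k) := by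
  simp_rw [trace_underlyingAdjMatrix_pow_eq_card _ hk]
  exact card_hom_sub_labelledCopyCount_isLittleO hn _

theorem trace_underlyingAdjMatrix_pow_isTheta (hG : ∀ i, (G i).IsOriented)
    (hm : ∃ c : ℝ, 0 < c ∧ ∀ᶠ i in atTop, c * (Fintype.card (V i) : ℝ) ^ 2 ≤ (G i).numEdges)
    {k : ℕ} (hk : Even k) (hk4 : 4 ≤ k) :
    (fun i => ((G i).underlyingAdjMatrix ^ k).trace) =Θ[atTop] (fun i => order V i ^ k) := by
  simp_rw [trace_underlyingAdjMatrix_pow_eq_card _ (show 2 ≤ k by omega)]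
  exact card_hom_isTheta hG hm (colorable_cycleGraph hk hk4)

/-- Since 2 E_k is the sum of the two traces and the unsigned one is N_L(C_k) + o(n^k), the error in
E_k is half of the signed trace up to o(n^k). -/
theorem evenSwitchCount_isLittleO_iff (hG : ∀ i, (G i).IsOriented)
    (hn : Tendsto (fun i => Fintype.card (V i)) atTop atTop)
    (hm : ∃ c : ℝ, 0 < c ∧ ∀ᶠ i in atTop, c * (Fintype.card (V i) : ℝ) ^ 2 ≤ (G i).numEdges)
    {k : ℕ} (hk : Even k) (hk4 : 4 ≤ k) :
    (fun i => ((G i).evenSwitchCount k : ℝ)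
        - 1 / 2 * ((G i).underlying.labelledCopyCount (SimpleGraph.cycleGraph k) : ℝ))
      =o[atTop] (fun i => ((G i).underlying.labelledCopyCount (SimpleGraph.cycleGraph k) : ℝ)) ↔
    (fun i => ((G i).adjMatrix ^ k).trace) =o[atTop] (fun i => order V i ^ k) := by
  rw [(labelledCopyCount_isTheta hG hn hm (colorable_cycleGraph hk hk4)).isLittleO_congr_right]
  have h1 := trace_underlyingAdjMatrix_pow_sub_isLittleO (G := G) hn (show 2 ≤ k by omega)
  have h2 : ∀ i, 2 * ((G i).evenSwitchCount k : ℝ) = _ := fun i =>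
    two_mul_evenSwitchCount (hG i) (show 0 < k by omega)
  constructor
  · intro h
    refine ((h.const_mul_left 2).sub h1).congr_left fun i => ?_
    rw [mul_sub, h2]
    ring
  · intro h
    refine ((h1.add h).const_mul_left (1 / 2)).congr_left fun i => ?_
    have := h2 i
    linarith

theorem trace_adjMatrix_pow_isLittleO (hG : ∀ i, (G i).IsOriented)
    (hn : Tendsto (fun i => Fintype.card (V i)) atTop atTop)
    (ht : (fun i => (G i).tau) =o[atTop] fun i => order V i ^ 2) {k : ℕ} (hk : 3 ≤ k) :
    (fun i => ((G i).adjMatrix ^ k).trace) =o[atTop] (fun i => order V i ^ k) :=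
  isLittleO_of_sq_order_mul_le hn (C := 4) ht fun i =>
    (sq_card_mul_abs_trace_le (hG i) hk).trans (le_of_eq (by ring))

theorem absLambdaOne_underlyingAdjMatrix_isTheta (hG : ∀ i, (G i).IsOriented)
    (hn : Tendsto (fun i => Fintype.card (V i)) atTop atTop)
    (hm : ∃ c : ℝ, 0 < c ∧ ∀ᶠ i in atTop, c * (Fintype.card (V i) : ℝ) ^ 2 ≤ (G i).numEdges) :
    (fun i => absLambdaOne (G i).underlyingAdjMatrix) =Θ[atTop] order V := by
  obtain ⟨c, hc, hm⟩ := hm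
  refine ⟨IsBigO.of_bound' ?_, IsBigO.of_bound (2 * c)⁻¹ ?_⟩
  · filter_upwards [eventually_nonempty hn] with i hi
    rw [Real.norm_of_nonneg (absLambdaOne_nonneg _), Real.norm_of_nonneg (Nat.cast_nonneg _)]
    exact absLambdaOne_underlyingAdjMatrix_le (hG i)
  · filter_upwards [hm, (tendsto_order hn).eventually_gt_atTop 0] with i h1 h2
    rw [Real.norm_of_nonneg (absLambdaOne_nonneg _), Real.norm_of_nonneg h2.le,
      le_inv_mul_iff₀ (by positivity)]
    refine le_of_mul_le_mul_right ?_ h2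
    have := two_mul_numEdges_le_absLambdaOne (hG i)
    calc 2 * c * order V i * order V i = 2 * (c * order V i ^ 2) := by ring
      _ ≤ 2 * (G i).numEdges := by gcongr
      _ ≤ _ := this

theorem absLambdaOne_isLittleO_of_trace (hG : ∀ i, (G i).IsOriented)
    (hn : Tendsto (fun i => Fintype.card (V i)) atTop atTop) {k : ℕ} (hk : Even k) (hk4 : 4 ≤ k)
    (h : (fun i => ((G i).adjMatrix ^ k).trace) =o[atTop] (fun i => order V i ^ k)) :
    (fun i => absLambdaOne (G i).adjMatrix) =o[atTop] order V := by
  obtain ⟨l, rfl⟩ := hk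
  rw [← two_mul] at *
  refine IsLittleO.of_pow (n := 2 * l) ?_ (by omega)
  refine h.abs_left.of_abs_le ?_
  filter_upwards [eventually_nonempty hn] with i hi
  rw [Pi.pow_apply, abs_of_nonneg (pow_nonneg (absLambdaOne_nonneg _) _)]
  exact absLambdaOne_pow_le (Or.inr (adjMatrix_transpose (hG i))) l

theorem tau_isLittleO_of_absLambdaOne (hG : ∀ i, (G i).IsOriented)
    (h : (fun i => absLambdaOne (G i).adjMatrix) =o[atTop] order V) :
    (fun i => (G i).tau) =o[atTop] fun i => order V i ^ 2 := by
  have h1 := h.mul_isBigO (isBigO_refl (order V) atTop)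
  simp_rw [← sq] at h1
  refine h1.of_abs_le (Eventually.of_forall fun i => ?_)
  rw [abs_of_nonneg (tau_nonneg _)]
  exact tau_le_absLambdaOne (hG i)

/-- Closes the cycle trace, eigenvalue, τ, trace for each single k, which is what makes one even k
enough. -/
theorem trace_adjMatrix_pow_isLittleO_iff (hG : ∀ i, (G i).IsOriented)
    (hn : Tendsto (fun i => Fintype.card (V i)) atTop atTop) {k : ℕ} (hk : Even k) (hk4 : 4 ≤ k) :
    (fun i => ((G i).adjMatrix ^ k).trace) =o[atTop] (fun i => order V i ^ k) ↔
      (fun i => (G i).tau) =o[atTop] fun i => order V i ^ 2 :=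
  ⟨fun h => tau_isLittleO_of_absLambdaOne hG (absLambdaOne_isLittleO_of_trace hG hn hk hk4 h),
    fun h => trace_adjMatrix_pow_isLittleO hG hn h (by omega)⟩

/-- Tr A(G)⁴ is nonnegative, being the squared Frobenius norm of the symmetric matrix A(G)². The
trace inequality bounds it above by 16 times the homomorphism count minus Tr A(Ḡ)⁴, so no lower
bound on the 4-cycle count is needed. -/
theorem trace_adjMatrix_pow_four_isLittleO (hG : ∀ i, (G i).IsOriented)
    (hn : Tendsto (fun i => Fintype.card (V i)) atTop atTop)
    (h : (fun i => (fourCycle.labelledCount (G i) : ℝ)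
        - 1 / 16 * ((G i).underlying.labelledCopyCount (SimpleGraph.cycleGraph 4) : ℝ))
      =o[atTop] (fun i => order V i ^ 4)) :
    (fun i => ((G i).adjMatrix ^ 4).trace) =o[atTop] (fun i => order V i ^ 4) := by
  have h1 : (fun i => (Nat.card {f : Fin 4 → V i //
        ∀ x y, fourCycle.Adj x y → (G i).Adj (f x) (f y)} : ℝ)
      - fourCycle.labelledCount (G i)) =o[atTop] (fun i => order V i ^ 4) :=
    card_fun_sub_card_embedding_isLittleO hn
      fun i f => ∀ x y, fourCycle.Adj x y → (G i).Adj (f x) (f y)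
  have h2 := trace_underlyingAdjMatrix_pow_sub_isLittleO (G := G) hn (show 2 ≤ 4 by norm_num)
  refine (((h1.add h).const_mul_left 16).sub h2).of_abs_le (Eventually.of_forall fun i => ?_)
  have h3 := trace_add_trace_le_card_hom_fourCycle (hG i)
  have h4 : 0 ≤ ((G i).adjMatrix ^ 4).trace := by
    have := Matrix.trace_transpose_mul_self_nonneg ((G i).adjMatrix ^ 2)
    rwa [Matrix.transpose_pow, adjMatrix_transpose (hG i), neg_sq, ← pow_add] at this
  rw [abs_of_nonneg h4]
  linarith

end Asymptotics

end Digraph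

/-! ### Assembling the equivalences. -/

open Digraph

theorem mainTheorem6 {V : ℕ → Type*} [∀ i, Fintype (V i)] [∀ i, DecidableEq (V i)]
    (G : ∀ i, Digraph (V i)) (hG : ∀ i, (G i).IsOriented)
    (hn : Tendsto (fun i => Fintype.card (V i)) atTop atTop)
    (hm : ∃ c : ℝ, 0 < c ∧ ∀ᶠ i in atTop, c * (Fintype.card (V i) : ℝ) ^ 2 ≤ (G i).numEdges) :
    List.TFAE [
      (fun i => (G i).tau) =o[atTop] (fun i => ((G i).numEdges : ℝ)),
      (fun i => (G i).tauStar) =o[atTop] (fun i => ((G i).numEdges : ℝ)),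
      (fun i => (G i).surplus) =o[atTop] (fun i => ((G i).numEdges : ℝ)),
      (fun i => (Digraph.fourCycle.unlabelledCount (G i) : ℝ)
          - 1 / 8 * ((G i).underlying.copyCount (SimpleGraph.cycleGraph 4) : ℝ))
        =o[atTop] (fun i => ((G i).underlying.copyCount (SimpleGraph.cycleGraph 4) : ℝ)),
      ∀ (b : ℕ) (B : Digraph (Fin b)), B.IsOriented → B.underlying.IsBipartite →
        (fun i => (B.labelledCount (G i) : ℝ)
            - (1 / 2) ^ B.numEdges * ((G i).underlying.labelledCopyCount B.underlying : ℝ))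
          =o[atTop] (fun i => ((G i).underlying.labelledCopyCount B.underlying : ℝ)),
      ∀ k : ℕ, Even k → 4 ≤ k →
        (fun i => ((G i).evenSwitchCount k : ℝ)
            - 1 / 2 * ((G i).underlying.labelledCopyCount (SimpleGraph.cycleGraph k) : ℝ))
          =o[atTop]
            (fun i => ((G i).underlying.labelledCopyCount (SimpleGraph.cycleGraph k) : ℝ)),
      ∀ k : ℕ, Even k → 4 ≤ k →
        (fun i => ((G i).adjMatrix ^ k).trace)
          =o[atTop] (fun i => ((G i).underlyingAdjMatrix ^ k).trace),
      (fun i => absLambdaOne (G i).adjMatrix)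
        =o[atTop] (fun i => absLambdaOne (G i).underlyingAdjMatrix),
      ∃ δ : ℕ → ℝ, (∀ i, 0 < δ i ∧ δ i < 1) ∧ Tendsto δ atTop (𝓝 1) ∧
        (fun i => (G i).bias (δ i)) =o[atTop] (fun i => ((G i).numEdges : ℝ))] ∧
    ∀ k : ℕ, Even k → 4 ≤ k →
      List.TFAE [
        (fun i => (G i).tau) =o[atTop] (fun i => ((G i).numEdges : ℝ)),
        (fun i => ((G i).evenSwitchCount k : ℝ)
            - 1 / 2 * ((G i).underlying.labelledCopyCount (SimpleGraph.cycleGraph k) : ℝ))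
          =o[atTop]
            (fun i => ((G i).underlying.labelledCopyCount (SimpleGraph.cycleGraph k) : ℝ)),
        (fun i => ((G i).adjMatrix ^ k).trace)
          =o[atTop] (fun i => ((G i).underlyingAdjMatrix ^ k).trace)] := by
  have hE := numEdges_isTheta (G := G) hm
  have hC4 := colorable_cycleGraph (k := 4) (by decide) le_rfl
  have hL4 := labelledCopyCount_isTheta hG hn hm hC4
  have h1 : (fun i => (G i).tau) =o[atTop] (fun i => ((G i).numEdges : ℝ)) ↔
      (fun i => (G i).tau) =o[atTop] fun i => order V i ^ 2 := hE.isLittleO_congr_right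
  have h7 : ∀ k : ℕ, Even k → 4 ≤ k →
      ((fun i => ((G i).adjMatrix ^ k).trace)
          =o[atTop] (fun i => ((G i).underlyingAdjMatrix ^ k).trace) ↔
        (fun i => (G i).tau) =o[atTop] fun i => order V i ^ 2) := fun k hk hk4 =>
    (trace_underlyingAdjMatrix_pow_isTheta hG hm hk hk4).isLittleO_congr_right.trans
      (trace_adjMatrix_pow_isLittleO_iff hG hn hk hk4)
  have h6 : ∀ k : ℕ, Even k → 4 ≤ k →
      ((fun i => ((G i).evenSwitchCount k : ℝ)
            - 1 / 2 * ((G i).underlying.labelledCopyCount (SimpleGraph.cycleGraph k) : ℝ))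
          =o[atTop]
            (fun i => ((G i).underlying.labelledCopyCount (SimpleGraph.cycleGraph k) : ℝ)) ↔
        (fun i => (G i).tau) =o[atTop] fun i => order V i ^ 2) := fun k hk hk4 =>
    (evenSwitchCount_isLittleO_iff hG hn hm hk hk4).trans
      (trace_adjMatrix_pow_isLittleO_iff hG hn hk hk4)
  have hcopy : ∀ i, ((G i).underlying.labelledCopyCount (SimpleGraph.cycleGraph 4) : ℝ)
      = 8 * ((G i).underlying.copyCount (SimpleGraph.cycleGraph 4) : ℝ) := fun i => by
    exact_mod_cast labelledCopyCount_cycleGraph_four (G i).underlying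
  have hlab : ∀ i, (fourCycle.labelledCount (G i) : ℝ)
      = 4 * (fourCycle.unlabelledCount (G i) : ℝ) := fun i => by
    exact_mod_cast labelledCount_fourCycle (G i)
  -- With 4 automorphisms of the oriented and 8 of the undirected 4-cycle, the unlabelled ratio 1/8
  -- is the labelled ratio 2⁻⁴ = 1/16.
  have h4 : (fun i => (fourCycle.unlabelledCount (G i) : ℝ)
          - 1 / 8 * ((G i).underlying.copyCount (SimpleGraph.cycleGraph 4) : ℝ))
        =o[atTop] (fun i => ((G i).underlying.copyCount (SimpleGraph.cycleGraph 4) : ℝ)) ↔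
      (fun i => (fourCycle.labelledCount (G i) : ℝ)
        - 1 / 16 * ((G i).underlying.labelledCopyCount (SimpleGraph.cycleGraph 4) : ℝ))
      =o[atTop] (fun i => order V i ^ 4) := by
    rw [← hL4.isLittleO_congr_right]
    simp_rw [hcopy, hlab]
    rw [isLittleO_const_mul_right_iff (by norm_num : (8 : ℝ) ≠ 0),
      ← isLittleO_const_mul_left_iff (by norm_num : (4 : ℝ) ≠ 0)]
    refine isLittleO_congr (Eventually.of_forall fun i => ?_) EventuallyEq.rfl
    ring
  refine ⟨?_, fun k hk hk4 => ?_⟩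
  · tfae_have 1 → 2 := fun h => h.of_abs_le (Eventually.of_forall fun i => by
      rw [abs_of_nonneg (tauStar_nonneg _)]
      exact tauStar_le_tau _)
    tfae_have 2 → 1 := fun h => (h.const_mul_left 3).of_abs_le (Eventually.of_forall fun i => by
      rw [abs_of_nonneg (tau_nonneg _)]
      exact tau_le_three_mul_tauStar (hG i))
    tfae_have 1 → 3 := fun h =>
      hE.isLittleO_congr_right.2 (surplus_isLittleO hG hn (h1.1 h))
    tfae_have 3 → 2 := fun h => (h.const_mul_left 2).of_abs_le (Eventually.of_forall fun i => by
      rw [abs_of_nonneg (tauStar_nonneg _)]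
      exact tauStar_le_two_mul_surplus (hG i))
    tfae_have 1 → 5 := fun h b B hB hb =>
      (labelledCopyCount_isTheta hG hn hm hb).isLittleO_congr_right.2
        (labelledCount_sub_isLittleO hG hn (h1.1 h) hB)
    tfae_have 5 → 4 := fun h => by
      have h5 := h 4 fourCycle isOriented_fourCycle (by rw [underlying_fourCycle]; exact hC4)
      rw [underlying_fourCycle, numEdges_fourCycle, hL4.isLittleO_congr_right] at h5
      rw [h4]
      norm_num at h5 ⊢
      exact h5
    tfae_have 4 → 1 := fun h => h1.2 ((trace_adjMatrix_pow_isLittleO_iff hG hn (by decide) le_rfl).1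
      (trace_adjMatrix_pow_four_isLittleO hG hn (h4.1 h)))
    tfae_have 1 → 6 := fun h k hk hk4 => (h6 k hk hk4).2 (h1.1 h)
    tfae_have 6 → 1 := fun h => h1.2 ((h6 4 (by decide) le_rfl).1 (h 4 (by decide) le_rfl))
    tfae_have 1 → 7 := fun h k hk hk4 => (h7 k hk hk4).2 (h1.1 h)
    tfae_have 7 → 1 := fun h => h1.2 ((h7 4 (by decide) le_rfl).1 (h 4 (by decide) le_rfl))
    tfae_have 1 → 8 := fun h =>
      (absLambdaOne_underlyingAdjMatrix_isTheta hG hn hm).isLittleO_congr_right.2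
        (absLambdaOne_isLittleO_of_trace hG hn (k := 4) (by decide) le_rfl
          (trace_adjMatrix_pow_isLittleO hG hn (h1.1 h) (by norm_num)))
    tfae_have 8 → 1 := fun h => h1.2 (tau_isLittleO_of_absLambdaOne hG
      ((absLambdaOne_underlyingAdjMatrix_isTheta hG hn hm).isLittleO_congr_right.1 h))
    tfae_have 1 ↔ 9 := h1.trans (bias_isLittleO_iff hm).symm
    tfae_finish
  · tfae_have 1 ↔ 2 := h1.trans (h6 k hk hk4).symm
    tfae_have 1 ↔ 3 := h1.trans (h7 k hk hk4).symm
    tfae_finish
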